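/- Let $\mathcal D$ be the upper semilattice of Turing degrees, with join $\cup$ and jump $\mathbf d\mapsto\mathbf d'$. An upper semilattice $\mathcal U$ is called $\Sigma^0_1(\mathbf d)$-presentable if there are a reflexive and transitive relation $\le'$ on $\omega$ that is r.e. in $\mathbf d$ and a binary operation $\vee'$ on $\omega$ that is recursive in $\mathbf d$ such that $\mathcal U$ is isomorphic to the set of equivalence classes of the relation $i\le' j\ \&\ j\le' i$, with the order induced by $\le'$ and the join induced by $\vee'$. A degree $\mathbf g$ is hyperimmune-free relative to $\mathbf a$ if every function $\omega\to\omega$ recursive in $\mathbf g\cup\mathbf a$ is dominated by a function recursive in $\mathbf a$. Lemma 2.9 (the Lowness Conjecture holds for every $\mathbf g$ that is hyperimmune-free relative to $\mathbf a$). Let $\mathbf a,\mathbf g,\mathbf x\in\mathcal D$ with $\mathbf a\le\mathbf g\le\mathbf x$, where $\mathbf x\ge\mathbf a''$ or $\mathbf x=\mathbf a'$. Suppose that the interval $[\mathbf a,\mathbf g]=\{\mathbf y\in\mathcal D:\mathbf a\le\mathbf y\le\mathbf g\}$ is a lattice, that $\mathbf g\in\mathrm{GL}_1(\mathbf a)$,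 i.e. $\mathbf g'=\mathbf g\cup\mathbf a'$, and that $\mathbf g$ is hyperimmune-free relative to $\mathbf a$. Then $[\mathbf a,\mathbf g]$ is $\Sigma^0_1(\mathbf x)$-presentable. -/

import Mathlib

namespace Degrees

/-! ### Turing reducibility between sets of natural numbers -/

open Classical in
/-- The characteristic function of a set of natural numbers. -/
noncomputable def chi (A : Set ℕ) (n : ℕ) : ℕ := if n ∈ A then 1 else 0

theorem chi_congr {A B : Set ℕ} {m n : ℕ} (h : m ∈ A ↔ n ∈ B) : chi A m = chi B n := by
  unfold chi
  by_cases hn : n ∈ B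
  · rw [if_pos hn, if_pos (h.2 hn)]
  · rw [if_neg hn, if_neg (fun hm => hn (h.1 hm))]

/-- The oracle `A`, as the total function on `ℕ` that answers membership queries. -/
noncomputable def oracle (A : Set ℕ) : ℕ →. ℕ := fun n => Part.some (chi A n)

/-- Turing reducibility `A ≤_T B` of sets: the characteristic function of `A` is
recursive in that of `B`. -/
def Reducible (A B : Set ℕ) : Prop := ComputableIn {oracle B} (chi A)

theorem reducible_iff {A B : Set ℕ} :
    Reducible A B ↔ Nat.RecursiveIn {oracle B} (oracle A) :=
  RecursiveIn.iff_nat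

theorem Reducible.refl (A : Set ℕ) : Reducible A A :=
  reducible_iff.2 (.oracle _ rfl)

theorem Reducible.trans {A B C : Set ℕ} (h₁ : Reducible A B) (h₂ : Reducible B C) :
    Reducible A C :=
  reducible_iff.2 <| (reducible_iff.1 h₁).subst fun g hg => by
    rw [Set.mem_singleton_iff.1 hg]
    exact reducible_iff.1 h₂

/-- The recursive join `A ⊕ B = {2n | n ∈ A} ∪ {2n + 1 | n ∈ B}`. -/
def setJoin (A B : Set ℕ) : Set ℕ :=
  {n | (n % 2 = 0 ∧ n / 2 ∈ A) ∨ (n % 2 = 1 ∧ n / 2 ∈ B)}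

theorem Reducible.of_comp {A B : Set ℕ} {f : ℕ → ℕ} (hf : Primrec f)
    (h : ∀ n, n ∈ A ↔ f n ∈ B) : Reducible A B := by
  refine reducible_iff.2 (Nat.RecursiveIn.of_eq
    (Nat.RecursiveIn.comp (.oracle (oracle B) rfl)
      (Nat.Primrec.recursiveIn (Primrec.nat_iff.1 hf))) fun n => ?_)
  exact (Part.bind_some _ _).trans (congrArg Part.some (chi_congr (h n).symm))

theorem reducible_setJoin_left (A B : Set ℕ) : Reducible A (setJoin A B) :=
  .of_comp (f := fun n => 2 * n) (Primrec.nat_mul.comp (.const 2) .id)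
    fun n => by simp [setJoin]

theorem reducible_setJoin_right (A B : Set ℕ) : Reducible B (setJoin A B) :=
  .of_comp (f := fun n => 2 * n + 1)
    (Primrec.succ.comp (Primrec.nat_mul.comp (.const 2) .id))
    fun n => by
      have h : (2 * n + 1) / 2 = n := by omega
      simp [setJoin, h]

theorem setJoin_reducible {A B C : Set ℕ} (hA : Reducible A C) (hB : Reducible B C) :
    Reducible (setJoin A B) C := by
  have half : Nat.RecursiveIn {oracle C} (fun n : ℕ => ((n / 2 : ℕ) : Part ℕ)) :=
    Nat.Primrec.recursiveIn (f := fun n => n / 2)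
      (Primrec.nat_iff.1 (Primrec.nat_div.comp .id (.const 2)))
  have ha := Nat.RecursiveIn.comp (reducible_iff.1 hA) half
  have hb := Nat.RecursiveIn.comp (reducible_iff.1 hB) half
  have hid : Nat.RecursiveIn {oracle C} (fun n : ℕ => (n : Part ℕ)) :=
    Nat.Primrec.recursiveIn (f := fun n => n) Nat.Primrec.id
  have hsel : Primrec fun p : ℕ =>
      if p.unpair.1 % 2 = 0 then p.unpair.2.unpair.1 else p.unpair.2.unpair.2 := by
    have h2 := Primrec.unpair.comp (Primrec.snd.comp Primrec.unpair)
    exact Primrec.ite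
      (Primrec.eq.comp
        (Primrec.nat_mod.comp (Primrec.fst.comp Primrec.unpair) (.const 2)) (.const 0))
      (Primrec.fst.comp h2) (Primrec.snd.comp h2)
  refine reducible_iff.2 (Nat.RecursiveIn.of_eq
    (Nat.RecursiveIn.comp (Nat.Primrec.recursiveIn (Primrec.nat_iff.1 hsel))
      (Nat.RecursiveIn.pair hid (Nat.RecursiveIn.pair ha hb))) fun n => ?_)
  have e : ∀ D : Set ℕ,
      ((((n / 2 : ℕ) : Part ℕ) >>= oracle D : Part ℕ)) = Part.some (chi D (n / 2)) :=
    fun D => Part.bind_some _ _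
  simp only [e]
  rcases Nat.mod_two_eq_zero_or_one n with h | h
  · have hA : chi (setJoin A B) n = chi A (n / 2) := chi_congr (by simp [setJoin, h])
    simp [oracle, hA, h, Seq.seq]
  · have hB : chi (setJoin A B) n = chi B (n / 2) := chi_congr (by simp [setJoin, h])
    simp [oracle, hB, h, Seq.seq]

/-! ### Oracle programs and the Turing jump -/

/-- Programs with an oracle, with one constructor for each of the generators of the class of
partial functions that are recursive in the oracle. -/
inductive Code : Type
  | zero : Code
  | succ : Code
  | left : Code
  | right : Code
  | oracle : Code
  | pair : Code → Code → Code
  | comp : Code → Code → Code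
  | prec : Code → Code → Code
  | rfind : Code → Code

namespace Code

/-- The partial function computed by a program with oracle `A`. -/
noncomputable def eval (A : Set ℕ) : Code → ℕ →. ℕ
  | zero => fun _ => 0
  | succ => Nat.succ
  | left => fun n => (Nat.unpair n).1
  | right => fun n => (Nat.unpair n).2
  | oracle => Degrees.oracle A
  | pair f h => fun n => Nat.pair <$> eval A f n <*> eval A h n
  | comp f h => fun n => eval A h n >>= eval A f
  | prec f h => fun p =>
      let (a, n) := Nat.unpair p
      n.rec (eval A f a) fun y IH => do
        let i ← IH
        eval A h (Nat.pair a (Nat.pair y i))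
  | rfind f => fun a => Nat.rfind fun n => (fun m => m = 0) <$> eval A f (Nat.pair a n)

/-- The effective numbering of the programs: `ofNat e` is the `e`-th program. -/
def ofNat : ℕ → Code
  | 0 => zero
  | 1 => succ
  | 2 => left
  | 3 => right
  | 4 => oracle
  | n + 5 =>
    have hm : n / 4 < n + 5 := lt_of_le_of_lt (Nat.div_le_self n 4) (by omega)
    have _m1 : (n / 4).unpair.1 < n + 5 := lt_of_le_of_lt (Nat.unpair_left_le _) hm
    have _m2 : (n / 4).unpair.2 < n + 5 := lt_of_le_of_lt (Nat.unpair_right_le _) hm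
    match n % 4 with
    | 0 => pair (ofNat (n / 4).unpair.1) (ofNat (n / 4).unpair.2)
    | 1 => comp (ofNat (n / 4).unpair.1) (ofNat (n / 4).unpair.2)
    | 2 => prec (ofNat (n / 4).unpair.1) (ofNat (n / 4).unpair.2)
    | _ => rfind (ofNat (n / 4))

/-- The partial functions recursive in `A` are exactly those computed by programs with
oracle `A`. -/
theorem exists_eval {A : Set ℕ} {f : ℕ →. ℕ} :
    Nat.RecursiveIn {Degrees.oracle A} f ↔ ∃ c : Code, c.eval A = f := by
  constructor
  · intro hf
    induction hf with
    | zero => exact ⟨zero, rfl⟩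
    | succ => exact ⟨succ, rfl⟩
    | left => exact ⟨left, rfl⟩
    | right => exact ⟨right, rfl⟩
    | oracle g hg => exact ⟨oracle, (Set.mem_singleton_iff.1 hg).symm⟩
    | pair _ _ h₁ h₂ =>
      obtain ⟨c, rfl⟩ := h₁
      obtain ⟨d, rfl⟩ := h₂
      exact ⟨pair c d, rfl⟩
    | comp _ _ h₁ h₂ =>
      obtain ⟨c, rfl⟩ := h₁
      obtain ⟨d, rfl⟩ := h₂
      exact ⟨comp c d, rfl⟩
    | prec _ _ h₁ h₂ =>
      obtain ⟨c, rfl⟩ := h₁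
      obtain ⟨d, rfl⟩ := h₂
      exact ⟨prec c d, rfl⟩
    | rfind _ h =>
      obtain ⟨c, rfl⟩ := h
      exact ⟨rfind c, rfl⟩
  · rintro ⟨c, rfl⟩
    induction c with
    | zero => exact .zero
    | succ => exact .succ
    | left => exact .left
    | right => exact .right
    | oracle => exact .oracle _ rfl
    | pair c d h₁ h₂ => exact .pair h₁ h₂
    | comp c d h₁ h₂ => exact .comp h₁ h₂
    | prec c d h₁ h₂ => exact .prec h₁ h₂
    | rfind c h => exact .rfind h

theorem ofNat_pair {n : ℕ} (h : n % 4 = 0) :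
    ofNat (n + 5) = pair (ofNat (n / 4).unpair.1) (ofNat (n / 4).unpair.2) := by
  rw [ofNat, h]; rfl

theorem ofNat_comp {n : ℕ} (h : n % 4 = 1) :
    ofNat (n + 5) = comp (ofNat (n / 4).unpair.1) (ofNat (n / 4).unpair.2) := by
  rw [ofNat, h]; rfl

theorem ofNat_prec {n : ℕ} (h : n % 4 = 2) :
    ofNat (n + 5) = prec (ofNat (n / 4).unpair.1) (ofNat (n / 4).unpair.2) := by
  rw [ofNat, h]; rfl

theorem ofNat_rfind {n : ℕ} (h : n % 4 = 3) : ofNat (n + 5) = rfind (ofNat (n / 4)) := by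
  rw [ofNat, h]; rfl

theorem four_mul_add (q : ℕ) {r : ℕ} (hr : r < 4) :
    (4 * q + r) / 4 = q ∧ (4 * q + r) % 4 = r := by omega

/-- Every program has a number. -/
theorem ofNat_surjective : Function.Surjective ofNat := by
  intro c
  induction c with
  | zero => exact ⟨0, by rw [ofNat]⟩
  | succ => exact ⟨1, by rw [ofNat]⟩
  | left => exact ⟨2, by rw [ofNat]⟩
  | right => exact ⟨3, by rw [ofNat]⟩
  | oracle => exact ⟨4, by rw [ofNat]⟩
  | pair c d h₁ h₂ =>
    obtain ⟨a, rfl⟩ := h₁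
    obtain ⟨b, rfl⟩ := h₂
    obtain ⟨hd, hm⟩ := four_mul_add (Nat.pair a b) (r := 0) (by omega)
    exact ⟨_, by rw [ofNat_pair hm, hd, Nat.unpair_pair]⟩
  | comp c d h₁ h₂ =>
    obtain ⟨a, rfl⟩ := h₁
    obtain ⟨b, rfl⟩ := h₂
    obtain ⟨hd, hm⟩ := four_mul_add (Nat.pair a b) (r := 1) (by omega)
    exact ⟨_, by rw [ofNat_comp hm, hd, Nat.unpair_pair]⟩
  | prec c d h₁ h₂ =>
    obtain ⟨a, rfl⟩ := h₁
    obtain ⟨b, rfl⟩ := h₂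
    obtain ⟨hd, hm⟩ := four_mul_add (Nat.pair a b) (r := 2) (by omega)
    exact ⟨_, by rw [ofNat_prec hm, hd, Nat.unpair_pair]⟩
  | rfind c h =>
    obtain ⟨a, rfl⟩ := h
    obtain ⟨hd, hm⟩ := four_mul_add a (r := 3) (by omega)
    exact ⟨_, by rw [ofNat_rfind hm, hd]⟩

theorem eval_comp (A : Set ℕ) (f h : Code) (x : ℕ) :
    (comp f h).eval A x = (h.eval A x).bind (f.eval A) := rfl

/-- Replace the oracle calls in a program by calls of the program `k`. -/
def subst (k : Code) : Code → Code
  | zero => zero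
  | succ => succ
  | left => left
  | right => right
  | oracle => k
  | pair f h => pair (subst k f) (subst k h)
  | comp f h => comp (subst k f) (subst k h)
  | prec f h => prec (subst k f) (subst k h)
  | rfind f => rfind (subst k f)

theorem eval_subst {A B : Set ℕ} {k : Code} (hk : k.eval B = Degrees.oracle A) (c : Code) :
    (subst k c).eval B = c.eval A := by
  induction c <;> simp only [subst, eval, *] <;> rfl

/-- The action of `subst` on numbers of programs. -/
def substNum (k : ℕ) : ℕ → ℕ
  | 0 => 0
  | 1 => 1
  | 2 => 2
  | 3 => 3
  | 4 => k
  | n + 5 =>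
    have hm : n / 4 < n + 5 := lt_of_le_of_lt (Nat.div_le_self n 4) (by omega)
    have _m1 : (n / 4).unpair.1 < n + 5 := lt_of_le_of_lt (Nat.unpair_left_le _) hm
    have _m2 : (n / 4).unpair.2 < n + 5 := lt_of_le_of_lt (Nat.unpair_right_le _) hm
    4 * (if n % 4 = 3 then substNum k (n / 4)
      else Nat.pair (substNum k (n / 4).unpair.1) (substNum k (n / 4).unpair.2)) + n % 4 + 5

theorem ofNat_substNum (k n : ℕ) : ofNat (substNum k n) = subst (ofNat k) (ofNat n) := by
  induction n using Nat.strong_induction_on with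
  | _ n ih =>
    match n, ih with
    | 0, _ => simp only [substNum, ofNat, subst]
    | 1, _ => simp only [substNum, ofNat, subst]
    | 2, _ => simp only [substNum, ofNat, subst]
    | 3, _ => simp only [substNum, ofNat, subst]
    | 4, _ => simp only [substNum, ofNat, subst]
    | n + 5, ih =>
      have hm : n / 4 < n + 5 := lt_of_le_of_lt (Nat.div_le_self n 4) (by omega)
      have m1 := ih _ (lt_of_le_of_lt (Nat.unpair_left_le _) hm)
      have m2 := ih _ (lt_of_le_of_lt (Nat.unpair_right_le _) hm)
      have m0 := ih _ hm
      have hr : n % 4 < 4 := Nat.mod_lt _ (by omega)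
      rw [substNum]
      obtain ⟨hd, hm'⟩ := four_mul_add (if n % 4 = 3 then substNum k (n / 4)
        else Nat.pair (substNum k (n / 4).unpair.1) (substNum k (n / 4).unpair.2)) hr
      obtain h | h | h | h : n % 4 = 0 ∨ n % 4 = 1 ∨ n % 4 = 2 ∨ n % 4 = 3 := by omega
      · rw [ofNat_pair (hm'.trans h), ofNat_pair h, hd, if_neg (by omega), Nat.unpair_pair, m1,
          m2, subst]
      · rw [ofNat_comp (hm'.trans h), ofNat_comp h, hd, if_neg (by omega), Nat.unpair_pair, m1,
          m2, subst]
      · rw [ofNat_prec (hm'.trans h), ofNat_prec h, hd, if_neg (by omega), Nat.unpair_pair, m1,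
          m2, subst]
      · rw [ofNat_rfind (hm'.trans h), ofNat_rfind h, hd, if_pos h, m0, subst]

theorem primrec_substNum (k : ℕ) : Primrec (substNum k) := by
  let m : List ℕ → ℕ := fun l => l.length - 5
  let v : List ℕ → ℕ → ℕ := fun l i => (l[i]?).getD 0
  let g : List ℕ → ℕ := fun l =>
    if l.length < 4 then l.length
    else if l.length = 4 then k
    else 4 * (if m l % 4 = 3 then v l (m l / 4)
      else Nat.pair (v l (m l / 4).unpair.1) (v l (m l / 4).unpair.2)) + m l % 4 + 5
  have hlen : Primrec fun l : List ℕ => l.length := Primrec.list_length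
  have hm : Primrec m := Primrec.nat_sub.comp hlen (.const 5)
  have hv : ∀ {f : List ℕ → ℕ}, Primrec f → Primrec fun l => v l (f l) := fun hf =>
    Primrec.option_getD.comp (Primrec.list_getElem?.comp .id hf) (.const 0)
  have hq : Primrec fun l => m l / 4 := Primrec.nat_div.comp hm (.const 4)
  have hr : Primrec fun l => m l % 4 := Primrec.nat_mod.comp hm (.const 4)
  have hu : Primrec fun l => (m l / 4).unpair := Primrec.unpair.comp hq
  have hg : Primrec g :=
    Primrec.ite (Primrec.nat_lt.comp hlen (.const 4)) hlen <|
    Primrec.ite (Primrec.eq.comp hlen (.const 4)) (.const k) <|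
    Primrec.nat_add.comp (Primrec.nat_add.comp (Primrec.nat_mul.comp (.const 4)
      (Primrec.ite (Primrec.eq.comp hr (.const 3)) (hv hq)
        (Primrec₂.natPair.comp (hv (Primrec.fst.comp hu)) (hv (Primrec.snd.comp hu))))) hr)
      (.const 5)
  have key : Primrec₂ fun (_ : Unit) n => substNum k n := by
    refine Primrec.nat_strong_rec (fun (_ : Unit) n => substNum k n)
      (g := fun _ l => some (g l)) (Primrec.option_some.comp (hg.comp Primrec.snd)) ?_
    intro _ n
    have hvn : ∀ i < n, v ((List.range n).map (substNum k)) i = substNum k i := by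
      intro i hi
      simp [v, hi]
    congr 1
    simp only [g, m, List.length_map, List.length_range]
    match n, hvn with
    | 0, _ => simp [substNum]
    | 1, _ => simp [substNum]
    | 2, _ => simp [substNum]
    | 3, _ => simp [substNum]
    | 4, _ => simp [substNum]
    | n + 5, hvn =>
      have hm : n / 4 < n + 5 := lt_of_le_of_lt (Nat.div_le_self n 4) (by omega)
      have m1 := hvn _ (lt_of_le_of_lt (Nat.unpair_left_le _) hm)
      have m2 := hvn _ (lt_of_le_of_lt (Nat.unpair_right_le _) hm)
      have m0 := hvn _ hm
      rw [substNum, if_neg (by omega), if_neg (by omega), Nat.add_sub_cancel, m0, m1, m2]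
  exact key.comp (.const ()) .id

/-- A number of a program that computes the constant function with value `n`. -/
def constNum : ℕ → ℕ
  | 0 => 0
  | n + 1 => 4 * Nat.pair 1 (constNum n) + 1 + 5

theorem eval_constNum (A : Set ℕ) (n x : ℕ) :
    (ofNat (constNum n)).eval A x = Part.some n := by
  induction n with
  | zero => rw [constNum, ofNat]; rfl
  | succ n ih =>
    obtain ⟨hd, hm⟩ := four_mul_add (Nat.pair 1 (constNum n)) (r := 1) (by omega)
    rw [constNum, ofNat_comp hm, hd, Nat.unpair_pair, eval_comp, ih, ofNat, eval]
    exact Part.bind_some _ _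

theorem primrec_constNum : Primrec constNum := by
  refine (Primrec.nat_rec₁ (f := fun _ c => 4 * Nat.pair 1 c + 1 + 5) 0 ?_).of_eq fun n => ?_
  · exact Primrec.nat_add.comp (Primrec.nat_add.comp (Primrec.nat_mul.comp (.const 4)
      (Primrec₂.natPair.comp (.const 1) Primrec.snd)) (.const 1)) (.const 5)
  · induction n with
    | zero => rfl
    | succ n ih => simp only [constNum, ← ih]

end Code

/-- The Turing jump `A' = {e | φ_e^A(e) converges}` of a set. -/
def setJump (A : Set ℕ) : Set ℕ := {e | ((Code.ofNat e).eval A e).Dom}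

theorem Reducible.setJump {A B : Set ℕ} (h : Reducible A B) :
    Reducible (setJump A) (setJump B) := by
  obtain ⟨c, hc⟩ := Code.exists_eval.1 (reducible_iff.1 h)
  obtain ⟨k, rfl⟩ := Code.ofNat_surjective c
  refine .of_comp
    (f := fun e => 4 * Nat.pair (Code.substNum k e) (Code.constNum e) + 1 + 5) ?_ fun e => ?_
  · exact Primrec.nat_add.comp (Primrec.nat_add.comp (Primrec.nat_mul.comp (.const 4)
      (Primrec₂.natPair.comp (Code.primrec_substNum k) Code.primrec_constNum))
      (.const 1)) (.const 5)
  · obtain ⟨hd, hm⟩ :=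
      Code.four_mul_add (Nat.pair (Code.substNum k e) (Code.constNum e)) (r := 1) (by omega)
    change _ ↔ ((Code.ofNat _).eval B _).Dom
    rw [Code.ofNat_comp hm, hd, Nat.unpair_pair, Code.eval_comp, Code.eval_constNum,
      Code.ofNat_substNum, Code.eval_subst hc]
    exact iff_of_eq (congrArg Part.Dom (Part.bind_some _ _).symm)

/-! ### Turing degrees -/

/-- Turing equivalence of sets of natural numbers. -/
def turingSetoid : Setoid (Set ℕ) where
  r A B := Reducible A B ∧ Reducible B A
  iseqv :=
    { refl := fun A => ⟨.refl A, .refl A⟩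
      symm := fun h => ⟨h.2, h.1⟩
      trans := fun h₁ h₂ => ⟨h₁.1.trans h₂.1, h₂.2.trans h₁.2⟩ }

/-- The Turing degrees. (Mathlib's `TuringDegree` consists of classes of arbitrary partial
functions; here the representatives are sets, as usual.) -/
def Deg : Type := Quotient turingSetoid

/-- The Turing degree of a set. -/
def deg (A : Set ℕ) : Deg := Quotient.mk turingSetoid A

/-- The order on the degrees: `deg A ≤ deg B` iff `A ≤_T B`. -/
instance : PartialOrder Deg where
  le := Quotient.lift₂ Reducible fun _ _ _ _ h₁ h₂ =>
    propext ⟨fun h => h₁.2.trans (h.trans h₂.1), fun h => h₁.1.trans (h.trans h₂.2)⟩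
  le_refl := Quotient.ind Reducible.refl
  le_trans := by
    rintro ⟨A⟩ ⟨B⟩ ⟨C⟩ h₁ h₂
    exact Reducible.trans h₁ h₂
  le_antisymm := by
    rintro ⟨A⟩ ⟨B⟩ h₁ h₂
    exact Quotient.sound ⟨h₁, h₂⟩

theorem deg_le_deg {A B : Set ℕ} : deg A ≤ deg B ↔ Reducible A B := Iff.rfl

/-- The degrees form an upper semilattice, the join being induced by the recursive join. -/
instance : SemilatticeSup Deg where
  sup := Quotient.map₂ setJoin fun _ _ h₁ _ _ h₂ =>
    ⟨setJoin_reducible (h₁.1.trans (reducible_setJoin_left _ _))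
        (h₂.1.trans (reducible_setJoin_right _ _)),
      setJoin_reducible (h₁.2.trans (reducible_setJoin_left _ _))
        (h₂.2.trans (reducible_setJoin_right _ _))⟩
  le_sup_left := by
    rintro ⟨A⟩ ⟨B⟩
    exact reducible_setJoin_left A B
  le_sup_right := by
    rintro ⟨A⟩ ⟨B⟩
    exact reducible_setJoin_right A B
  sup_le := by
    rintro ⟨A⟩ ⟨B⟩ ⟨C⟩ h₁ h₂
    exact setJoin_reducible h₁ h₂

theorem deg_sup_deg (A B : Set ℕ) : deg A ⊔ deg B = deg (setJoin A B) := rfl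

/-- The jump operator on the degrees. -/
def Deg.jump : Deg → Deg :=
  Quotient.map setJump fun _ _ h => ⟨h.1.setJump, h.2.setJump⟩

theorem jump_deg (A : Set ℕ) : (deg A).jump = deg (setJump A) := rfl

/-! ### Notions relative to a degree -/

/-- The total function `f` is recursive in the degree `d`, that is, in some
(equivalently, every) set of degree `d`. -/
def RecursiveInDeg {α σ : Type} [Primcodable α] [Primcodable σ] (d : Deg) (f : α → σ) : Prop :=
  ∃ A : Set ℕ, deg A = d ∧ ComputableIn {oracle A} f

/-- The set `W` is r.e. in the degree `d`: it is the domain of a partial function that is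
recursive in some (equivalently, every) set of degree `d`. -/
def REInDeg {α : Type} [Primcodable α] (d : Deg) (W : Set α) : Prop :=
  ∃ A : Set ℕ, deg A = d ∧
    ∃ f : α →. ℕ, RecursiveIn {oracle A} f ∧ ∀ x, x ∈ W ↔ (f x).Dom

/-- The function `h` dominates `f`. -/
def Dominates (h f : ℕ → ℕ) : Prop := ∀ᶠ n in Filter.atTop, f n ≤ h n

/-- `g` is hyperimmune-free relative to `a`: every function recursive in `g ∪ a` is dominated
by a function recursive in `a`. -/
def HyperimmuneFreeRel (g a : Deg) : Prop :=
  ∀ f : ℕ → ℕ, RecursiveInDeg (g ⊔ a) f → ∃ h : ℕ → ℕ, RecursiveInDeg a h ∧ Dominates h f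

/-- `g ∈ GL₁(a)`, that is, `g' = g ∪ a'`. -/
def GL1Rel (a g : Deg) : Prop := g.jump = g ⊔ a.jump

/-- A partial order is a lattice if every two elements have a least upper bound and a greatest
lower bound. -/
def IsLatticeOrder (P : Type) [PartialOrder P] : Prop :=
  ∀ b c : P, (∃ s, IsLUB {b, c} s) ∧ ∃ i, IsGLB {b, c} i

/-- A structure `(ω, ≤', ∨')` whose relation `≤'` is reflexive and transitive. -/
structure PreStructure where
  le : ℕ → ℕ → Prop
  join : ℕ → ℕ → ℕ
  isPreorder : IsPreorder ℕ le

/-- The set `L` of equivalence classes of the relation `i ≤' j & j ≤' i`. -/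
def PreStructure.Classes (p : PreStructure) : Type :=
  @Antisymmetrization ℕ p.le p.isPreorder

/-- The equivalence class of a number. -/
def PreStructure.toClass (p : PreStructure) (i : ℕ) : p.Classes :=
  @toAntisymmetrization ℕ p.le p.isPreorder i

/-- The upper semilattice `U` is `Σ⁰₁(d)`-presentable: for some `(ω, ≤', ∨')` with `≤'` r.e.
in `d` and `∨'` recursive in `d`, it is isomorphic to the set of equivalence classes, with the
order induced by `≤'` and the join induced by `∨'`. -/
def Sigma01Presentable (d : Deg) (U : Type) [SemilatticeSup U] : Prop :=
  ∃ p : PreStructure,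
    REInDeg d {x : ℕ × ℕ | p.le x.1 x.2} ∧
    RecursiveInDeg d (fun x : ℕ × ℕ => p.join x.1 x.2) ∧
    ∃ e : p.Classes ≃ U,
      (∀ i j, e (p.toClass i) ≤ e (p.toClass j) ↔ p.le i j) ∧
      ∀ i j, e (p.toClass (p.join i j)) = e (p.toClass i) ⊔ e (p.toClass j)

end Degrees

/-!
Write `a = deg A`, `g = deg G`, `x = deg X`.

Suppose first that `X` computes `A''`. By `GL1Rel` it also computes `G'`. The point is that
hyperimmune-freeness turns totality into a question that `X` can settle. If a set `B ≤_T G`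
computes a total function, then the number of steps needed on input `n` is a function recursive in
`G`, so it lies below a function recursive in `A` (`HyperimmuneFreeRel.exists_run_eq`). Hence every
set below `G` has a *clocked index*: a program together with an index `k` of a total `A`-recursive
bound on the running time. That `k` is an index of a total function is decidable in `A''`, and that
the bound suffices on every input is then a universal statement about a `G`-recursive function,
decidable in `G'`; so `X` decides which numbers are clocked indices (`decidableIn_good`). Likewise a
reduction of one set below `G` to the join of `A` with another can be taken to be clocked, and `X`
decides whether a given clocked program is such a reduction (`decidableIn_clockedReducible`). So the
order on clocked indices is r.e. in `X`. As `X` also decides whether `w` indexes the join of the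
sets indexed by `u` and `v` (`decidableIn_isJoinIndex`), a join index is found by search. The
degrees `a ⊔ deg B`, where `B` runs through the sets with clocked indices, exhaust `[a, g]`
(`sigma01Presentable_Icc`).

Suppose now that `x = a'`, so that `G ≤_T A'`. Then `G` is the limit of an `A`-recursive
approximation (`exists_limit`), and an `A`-recursive bound on the time until the approximation is
correct lets `A` compute `G` (`HyperimmuneFreeRel.reducible_of_le_jump`). Thus `g = a`, and the
interval has only one element.

Step counting is provided by `Code.run`, which evaluates a program along a finite initial segment of
the oracle, whose length serves as the time bound. It is monotone in the segment, it is correct and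
complete for `Code.eval` (`Code.mem_eval_iff`), and it is computable uniformly in the program
(`Code.computable_run`), because oracle programs can be translated effectively into Mathlib's
programs without oracle. The enumeration theorem `recursiveIn_phi` follows.
-/

/-! ### Closure properties of relative recursiveness -/

namespace RecursiveIn

variable {α β γ σ : Type*} [Primcodable α] [Primcodable β] [Primcodable γ] [Primcodable σ]
variable {O : Set (ℕ →. ℕ)}

theorem comp {f : β →. σ} {g : α → β} (hf : RecursiveIn O f) (hg : ComputableIn O g) :
    RecursiveIn O fun a => f (g a) :=
  (Nat.RecursiveIn.comp hf hg).of_eq fun n => by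
    rcases e : Encodable.decode (α := α) n with - | a <;> simp [Encodable.encodek]

theorem bind {f : α →. β} {g : α → β →. σ} (hf : RecursiveIn O f) (hg : RecursiveIn₂ O g) :
    RecursiveIn O fun a => (f a).bind (g a) :=
  (Nat.RecursiveIn.comp hg
    (.pair (Nat.Primrec.recursiveIn Nat.Primrec.id) hf)).of_eq fun n => by
    rcases e : Encodable.decode (α := α) n with - | a
    · simp [Seq.seq]
    · refine Part.ext fun v => ?_
      have h : ∀ w, w ∈ (f a).bind (g a) ↔ ∃ b ∈ f a, w ∈ g a b := fun w => Part.mem_bind_iff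
      simp [Seq.seq, e, Encodable.encodek, h]
      tauto

theorem map {f : α →. β} {g : α → β → σ} (hf : RecursiveIn O f) (hg : ComputableIn₂ O g) :
    RecursiveIn O fun a => (f a).map (g a) := by
  simpa [Part.bind_some_eq_map] using RecursiveIn.bind (g := fun a x => Part.some (g a x)) hf hg

theorem nat_rec {f : α → ℕ} {g : α →. σ} {h : α → ℕ × σ →. σ} (hf : ComputableIn O f)
    (hg : RecursiveIn O g) (hh : RecursiveIn₂ O h) :
    RecursiveIn O fun a => (f a).rec (g a) fun y IH => IH.bind fun i => h a (y, i) :=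
  (Nat.RecursiveIn.comp (Nat.RecursiveIn.prec hg hh)
    (.pair (Nat.Primrec.recursiveIn Nat.Primrec.id) hf)).of_eq fun n => by
    rcases e : Encodable.decode (α := α) n with - | a
    · simp [Seq.seq]
    · simp [Seq.seq]
      induction f a <;> simp_all

theorem rfind {p : α → ℕ →. Bool} (hp : RecursiveIn₂ O p) :
    RecursiveIn O fun a => Nat.rfind (p a) :=
  (Nat.RecursiveIn.rfind <| hp.map
    (((Primrec.dom_bool fun b => cond b 0 1).comp Primrec.snd).to₂.computableIn₂)).of_eq
    fun n => by
    rcases e : Encodable.decode (α := α) n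
    · simpa [e] using Nat.rfind_zero_none (fun _ => Part.none) rfl
    · simp [e, Part.map_map, Part.map_id']

end RecursiveIn

namespace ComputableIn

variable {α β γ σ : Type*} [Primcodable α] [Primcodable β] [Primcodable γ] [Primcodable σ]
variable {O : Set (ℕ →. ℕ)}

theorem comp {f : β → σ} {g : α → β} (hf : ComputableIn O f) (hg : ComputableIn O g) :
    ComputableIn O fun a => f (g a) :=
  RecursiveIn.comp (f := fun b => Part.some (f b)) hf hg

theorem pair {f : α → β} {g : α → γ} (hf : ComputableIn O f) (hg : ComputableIn O g) :
    ComputableIn O fun a => (f a, g a) :=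
  (RecursiveIn.bind (g := fun a b => (Part.some (g a)).map fun c => (b, c)) hf
    (RecursiveIn.map (f := fun p : α × β => Part.some (g p.1)) (hg.comp .fst)
      (Primrec.pair (Primrec.snd.comp Primrec.fst) Primrec.snd).computableIn)).of_eq
    fun a => by simp

theorem comp₂ {f : β → γ → σ} {g : α → β} {h : α → γ} (hf : ComputableIn₂ O f)
    (hg : ComputableIn O g) (hh : ComputableIn O h) : ComputableIn O fun a => f (g a) (h a) :=
  ComputableIn.comp hf (hg.pair hh)

theorem nat_rec {f : α → ℕ} {g : α → σ} {h : α → ℕ × σ → σ} (hf : ComputableIn O f)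
    (hg : ComputableIn O g) (hh : ComputableIn₂ O h) :
    ComputableIn O fun a => Nat.rec (motive := fun _ => σ) (g a) (fun y i => h a (y, i)) (f a) :=
  (RecursiveIn.nat_rec (g := fun a => Part.some (g a)) (h := fun a p => Part.some (h a p))
    hf hg hh).of_eq fun a => by
    beta_reduce
    generalize f a = n
    induction n <;> simp_all

theorem list_map_range {f : α → ℕ} {h : α → ℕ → σ} (hf : ComputableIn O f)
    (hh : ComputableIn₂ O h) : ComputableIn O fun a => (List.range (f a)).map (h a) := by
  refine RecursiveIn.of_eq (nat_rec (g := fun _ => ([] : List σ))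
    (h := fun a p => p.2 ++ [h a p.1]) hf (.const _) ?_) fun a => ?_
  · exact comp₂ Primrec.list_append.computableIn₂
      (ComputableIn.snd.comp .snd)
      (comp₂ Primrec.list_cons.computableIn₂
        (comp₂ hh .fst (ComputableIn.fst.comp .snd)) (.const _))
  · congr 1
    beta_reduce
    generalize f a = n
    induction n <;> simp_all [List.range_succ]

end ComputableIn

/-! ### Evaluation of programs along finite initial segments of the oracle -/

namespace Degrees

/-- The initial segment of length `t` of the characteristic function of `A`. -/
noncomputable def initSeg (A : Set ℕ) (t : ℕ) : List ℕ := (List.range t).map (chi A)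

theorem initSeg_prefix (A : Set ℕ) {s t : ℕ} (h : s ≤ t) : initSeg A s <+: initSeg A t := by
  obtain ⟨k, rfl⟩ := Nat.exists_eq_add_of_le h
  exact ⟨_, by rw [initSeg, initSeg, List.range_add, List.map_append]⟩

namespace Code

/-- Evaluation of a program with the finite oracle `σ`, where unbounded searches are cut off at the
length of `σ`. The value `v + 1` means that the program answers `v`; the value `0` means that
no answer has been found. In the clause for `rfind`, the state of the search is `0` while it
goes on, `1` once it has failed, and `y + 2` once `y` has been found. -/
def run (σ : List ℕ) : Code → ℕ → ℕ
  | zero, _ => 1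
  | succ, n => n + 2
  | left, n => n.unpair.1 + 1
  | right, n => n.unpair.2 + 1
  | oracle, n => (σ[n]?.map Nat.succ).getD 0
  | pair f h, n =>
      if run σ f n = 0 ∨ run σ h n = 0 then 0
      else Nat.pair (run σ f n - 1) (run σ h n - 1) + 1
  | comp f h, n => if run σ h n = 0 then 0 else run σ f (run σ h n - 1)
  | prec f h, p =>
      Nat.rec (motive := fun _ => ℕ) (run σ f p.unpair.1)
        (fun y i => if i = 0 then 0 else run σ h (Nat.pair p.unpair.1 (Nat.pair y (i - 1))))
        p.unpair.2
  | rfind f, a =>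
      Nat.rec (motive := fun _ => ℕ) 0
        (fun y s => if s = 0 then
            if run σ f (Nat.pair a y) = 0 then 1
            else if run σ f (Nat.pair a y) = 1 then y + 2 else 0
          else s) σ.length - 1

/-- A search in the form used by `run`: what the final states `0` and `y + 2` mean. -/
theorem search_spec (r : ℕ → ℕ) (t : ℕ) :
    let s := Nat.rec (motive := fun _ => ℕ) 0
        (fun y s => if s = 0 then if r y = 0 then 1 else if r y = 1 then y + 2 else 0 else s) t
    (s = 0 ↔ ∀ m < t, 2 ≤ r m) ∧
      ∀ y, s = y + 2 ↔ y < t ∧ r y = 1 ∧ ∀ m < y, 2 ≤ r m := by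
  induction t with
  | zero => simp
  | succ t ih =>
    simp only at ih ⊢
    generalize Nat.rec (motive := fun _ => ℕ) 0
        (fun y s => if s = 0 then if r y = 0 then 1 else if r y = 1 then y + 2 else 0 else s) t
        = s at ih
    obtain ⟨h0, hs⟩ := ih
    by_cases h : s = 0
    · have h1 := h0.1 h
      rw [if_pos h]
      constructor
      · constructor
        · intro hr m hm
          obtain hm | rfl := Nat.lt_succ_iff_lt_or_eq.1 hm
          · exact h1 m hm
          · split_ifs at hr
            omega
        · intro hr
          have := hr t (Nat.lt_succ_self t)
          rw [if_neg (by omega), if_neg (by omega)]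
      · intro y
        constructor
        · intro hr
          split_ifs at hr with h2 h3
          · omega
          · obtain rfl : t = y := by omega
            exact ⟨Nat.lt_succ_self t, h3, h1⟩
        · rintro ⟨hy, hy1, -⟩
          obtain hm | rfl := Nat.lt_succ_iff_lt_or_eq.1 hy
          · have := h1 y hm
            omega
          · rw [if_neg (by omega), if_pos hy1]
    · rw [if_neg h]
      refine ⟨⟨fun h' => absurd h' h, fun h' => absurd (h0.2 fun m hm => h' m (by omega)) h⟩,
        fun y => ⟨fun h' => ?_, fun h' => ?_⟩⟩
      · obtain ⟨a, b⟩ := (hs y).1 h'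
        exact ⟨by omega, b⟩
      · refine (hs y).2 ⟨?_, h'.2⟩
        by_contra hy
        refine h (h0.2 fun m hm => h'.2.2 m (by omega))

theorem run_rfind {σ : List ℕ} {f : Code} {a v : ℕ} :
    run σ (rfind f) a = v + 1 ↔ v < σ.length ∧ run σ f (Nat.pair a v) = 1 ∧
      ∀ m < v, 2 ≤ run σ f (Nat.pair a m) := by
  rw [← (search_spec (fun y => run σ f (Nat.pair a y)) σ.length).2 v, run]
  omega

theorem run_mono {σ τ : List ℕ} (h : σ <+: τ) (c : Code) {n v : ℕ}
    (hr : run σ c n = v + 1) : run τ c n = v + 1 := by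
  have pos : ∀ {f : Code} {n : ℕ}, (∀ {n v}, run σ f n = v + 1 → run τ f n = v + 1) →
      run σ f n ≠ 0 → run τ f n = run σ f n := fun ih h => by
    obtain ⟨w, hw⟩ := Nat.exists_eq_succ_of_ne_zero h
    rw [hw, ih hw]
  induction c generalizing n v with
  | zero | succ | left | right => exact hr
  | oracle =>
    simp only [run] at hr ⊢
    rcases e : σ[n]? with - | b
    · simp [e] at hr
    · rw [e] at hr
      obtain ⟨ρ, rfl⟩ := h
      rw [List.getElem?_append_left (List.getElem?_eq_some_iff.1 e).1, e]
      exact hr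
  | pair f g ihf ihg =>
    simp only [run] at hr ⊢
    split_ifs at hr with h0
    rw [not_or] at h0
    rw [pos ihf h0.1, pos ihg h0.2, if_neg (by omega), hr]
  | comp f g ihf ihg =>
    simp only [run] at hr ⊢
    split_ifs at hr with h0
    rw [pos ihg h0, if_neg h0, ihf hr]
  | prec f g ihf ihg =>
    simp only [run] at hr ⊢
    generalize n.unpair.2 = k at hr ⊢
    induction k generalizing v with
    | zero => exact ihf hr
    | succ k ih =>
      simp only at hr ⊢
      split_ifs at hr with h0
      obtain ⟨w, hw⟩ := Nat.exists_eq_succ_of_ne_zero h0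
      rw [hw] at hr
      rw [ih hw, if_neg (by omega)]
      exact ihg hr
  | rfind f ih =>
    rw [run_rfind] at hr ⊢
    refine ⟨hr.1.trans_le h.length_le, ih hr.2.1, fun m hm => ?_⟩
    have := hr.2.2 m hm
    rw [pos ih (by omega)]
    exact this

theorem mem_eval_of_run {A : Set ℕ} {t : ℕ} (c : Code) {n v : ℕ}
    (hr : run (initSeg A t) c n = v + 1) : v ∈ c.eval A n := by
  have pos : ∀ {f : Code} {n : ℕ},
      (∀ {n v}, run (initSeg A t) f n = v + 1 → v ∈ f.eval A n) →
      run (initSeg A t) f n ≠ 0 → f.eval A n = Part.some (run (initSeg A t) f n - 1) :=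
    fun ih h => Part.eq_some_iff.2 (ih (by omega))
  induction c generalizing n v with
  | zero | succ | left | right =>
    obtain rfl := Nat.succ_injective hr
    exact Part.mem_some _
  | oracle =>
    simp only [run, initSeg, List.getElem?_map] at hr
    by_cases hn : n < t
    · rw [List.getElem?_range hn] at hr
      obtain rfl := Nat.succ_injective hr
      exact Part.mem_some _
    · rw [List.getElem?_eq_none (by simpa using hn)] at hr
      cases hr
  | pair f g ihf ihg =>
    simp only [run] at hr
    split_ifs at hr with h0
    rw [not_or] at h0
    simp only [eval, pos ihf h0.1, pos ihg h0.2]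
    simp [Seq.seq]
    omega
  | comp f g ihf ihg =>
    simp only [run] at hr
    split_ifs at hr with h0
    rw [eval_comp, pos ihg h0]
    exact Part.mem_bind (Part.mem_some _) (ihf hr)
  | prec f g ihf ihg =>
    simp only [run, eval] at hr ⊢
    generalize n.unpair.2 = k at hr ⊢
    induction k generalizing v with
    | zero => exact ihf hr
    | succ k ih =>
      simp only at hr ⊢
      split_ifs at hr with h0
      obtain ⟨w, hw⟩ := Nat.exists_eq_succ_of_ne_zero h0
      rw [hw] at hr
      exact Part.mem_bind (ih hw) (ihg hr)
  | rfind f ih =>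
    rw [run_rfind] at hr
    refine Nat.mem_rfind.2 ⟨?_, fun {m} hm => ?_⟩
    · exact (Part.mem_map_iff _).2 ⟨0, ih hr.2.1, by simp⟩
    · have := hr.2.2 m hm
      rw [pos ih (by omega)]
      simp
      omega

theorem exists_run_of_mem_eval {A : Set ℕ} (c : Code) {n v : ℕ} (h : v ∈ c.eval A n) :
    ∃ t, run (initSeg A t) c n = v + 1 := by
  have up : ∀ {f : Code} {n v s t : ℕ}, s ≤ t → run (initSeg A s) f n = v + 1 →
      run (initSeg A t) f n = v + 1 := fun h => run_mono (initSeg_prefix A h) _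
  induction c generalizing n v with
  | zero | succ | left | right =>
    obtain rfl := Part.mem_some_iff.1 h
    exact ⟨0, rfl⟩
  | oracle =>
    obtain rfl := Part.mem_some_iff.1 h
    exact ⟨n + 1, by simp [run, initSeg]⟩
  | pair f g ihf ihg =>
    obtain ⟨a, ha, b, hb, rfl⟩ : ∃ a ∈ f.eval A n, ∃ b ∈ g.eval A n, Nat.pair a b = v := by
      simpa [eval, Seq.seq] using h
    obtain ⟨s, hs⟩ := ihf ha
    obtain ⟨t, ht⟩ := ihg hb
    refine ⟨max s t, ?_⟩
    simp only [run, up (le_max_left s t) hs, up (le_max_right s t) ht]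
    simp
  | comp f g ihf ihg =>
    rw [eval_comp] at h
    obtain ⟨a, ha, hv⟩ := Part.mem_bind_iff.1 h
    obtain ⟨s, hs⟩ := ihf hv
    obtain ⟨t, ht⟩ := ihg ha
    refine ⟨max s t, ?_⟩
    simp only [run, up (le_max_right s t) ht]
    simpa using up (le_max_left s t) hs
  | prec f g ihf ihg =>
    simp only [run, eval] at h ⊢
    generalize n.unpair.2 = k at h ⊢
    induction k generalizing v with
    | zero => exact ihf h
    | succ k ih =>
      obtain ⟨a, ha, hv⟩ := Part.mem_bind_iff.1 h
      obtain ⟨s, hs⟩ := ihg hv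
      obtain ⟨t, ht⟩ := ih ha
      refine ⟨max s t, ?_⟩
      have := run_mono (initSeg_prefix A (le_max_right s t)) (prec f g)
        (n := Nat.pair n.unpair.1 k) (v := a) (by simpa [run] using ht)
      simp only [run, Nat.unpair_pair] at this
      simp only [this]
      simpa using up (le_max_left s t) hs
  | rfind f ih =>
    obtain ⟨h1, h2⟩ := Nat.mem_rfind.1 h
    have hv : ∃ t, run (initSeg A t) f (Nat.pair n v) = 1 := by
      obtain ⟨b, hb, hb'⟩ := (Part.mem_map_iff _).1 h1
      obtain rfl : b = 0 := by simpa using hb'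
      exact ih hb
    have hm : ∀ k ≤ v, ∃ t, ∀ m < k, 2 ≤ run (initSeg A t) f (Nat.pair n m) := by
      intro k
      induction k with
      | zero => exact fun _ => ⟨0, fun m hm => absurd hm (Nat.not_lt_zero m)⟩
      | succ k ihk =>
        intro hk
        obtain ⟨s, hs⟩ := ihk (by omega)
        obtain ⟨b, hb, hb'⟩ := (Part.mem_map_iff _).1 (h2 (m := k) (by omega))
        obtain ⟨t, ht⟩ := ih hb
        have hb0 : b ≠ 0 := by simpa using hb'
        refine ⟨max s t, fun m hm => ?_⟩
        obtain hm | rfl := Nat.lt_succ_iff_lt_or_eq.1 hm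
        · have := hs m hm
          rw [up (le_max_left s t) (Nat.succ_pred_eq_of_pos (by omega)).symm]
          simp
          omega
        · rw [up (le_max_right s t) ht]
          omega
    obtain ⟨s, hs⟩ := hv
    obtain ⟨t, ht⟩ := hm v le_rfl
    refine ⟨max (v + 1) (max s t), run_rfind.2 ⟨?_, ?_, fun m hm => ?_⟩⟩
    · simp [initSeg]
    · exact up (by omega) hs
    · have := ht m hm
      rw [up (s := t) (by omega) (Nat.succ_pred_eq_of_pos (by omega)).symm]
      simp
      omega

/-- Bounded evaluation along longer and longer initial segments of `A` computes `eval A`. -/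
theorem mem_eval_iff {A : Set ℕ} {c : Code} {n v : ℕ} :
    v ∈ c.eval A n ↔ ∃ t, run (initSeg A t) c n = v + 1 :=
  ⟨exists_run_of_mem_eval c, fun ⟨_, h⟩ => mem_eval_of_run c h⟩

end Code

end Degrees

/-! ### Bounded evaluation is computable, uniformly in the program -/

namespace Degrees.Code

/-- The iterator of the inductive type of programs. -/
def fold {γ : Type} (z s l r o : γ) (p k q : γ → γ → γ) (m : γ → γ) : Code → γ
  | zero => z
  | succ => s
  | left => l
  | right => r
  | oracle => o
  | pair f h => p (fold z s l r o p k q m f) (fold z s l r o p k q m h)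
  | comp f h => k (fold z s l r o p k q m f) (fold z s l r o p k q m h)
  | prec f h => q (fold z s l r o p k q m f) (fold z s l r o p k q m h)
  | rfind f => m (fold z s l r o p k q m f)

/-- A function that is defined by iteration along programs is primitive recursive in the number of
the program. -/
theorem primrec_fold {γ : Type} [Primcodable γ] (z s l r o : γ) {p k q : γ → γ → γ} {m : γ → γ}
    (hp : Primrec₂ p) (hk : Primrec₂ k) (hq : Primrec₂ q) (hm : Primrec m) :
    Primrec fun e => fold z s l r o p k q m (ofNat e) := by
  let d : List γ → ℕ := fun L => L.length - 5
  let v : List γ → ℕ → γ := fun L i => (L[i]?).getD z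
  let g : List γ → γ := fun L =>
    if L.length = 0 then z else if L.length = 1 then s else if L.length = 2 then l
    else if L.length = 3 then r else if L.length = 4 then o
    else if d L % 4 = 0 then p (v L (d L / 4).unpair.1) (v L (d L / 4).unpair.2)
    else if d L % 4 = 1 then k (v L (d L / 4).unpair.1) (v L (d L / 4).unpair.2)
    else if d L % 4 = 2 then q (v L (d L / 4).unpair.1) (v L (d L / 4).unpair.2)
    else m (v L (d L / 4))
  have hlen : Primrec fun L : List γ => L.length := Primrec.list_length
  have hd : Primrec d := Primrec.nat_sub.comp hlen (.const 5)
  have hv : ∀ {f : List γ → ℕ}, Primrec f → Primrec fun L => v L (f L) := fun hf =>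
    Primrec.option_getD.comp (Primrec.list_getElem?.comp .id hf) (.const z)
  have hdiv : Primrec fun L => d L / 4 := Primrec.nat_div.comp hd (.const 4)
  have hmod : Primrec fun L => d L % 4 := Primrec.nat_mod.comp hd (.const 4)
  have hu : Primrec fun L => (d L / 4).unpair := Primrec.unpair.comp hdiv
  have hl : ∀ i, PrimrecPred fun L : List γ => L.length = i := fun i =>
    Primrec.eq.comp hlen (.const i)
  have hr : ∀ i, PrimrecPred fun L : List γ => d L % 4 = i := fun i =>
    Primrec.eq.comp hmod (.const i)
  have h1 := hv (Primrec.fst.comp hu)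
  have h2 := hv (Primrec.snd.comp hu)
  have hg : Primrec g :=
    Primrec.ite (hl 0) (.const z) <| Primrec.ite (hl 1) (.const s) <|
    Primrec.ite (hl 2) (.const l) <| Primrec.ite (hl 3) (.const r) <|
    Primrec.ite (hl 4) (.const o) <| Primrec.ite (hr 0) (hp.comp h1 h2) <|
    Primrec.ite (hr 1) (hk.comp h1 h2) <| Primrec.ite (hr 2) (hq.comp h1 h2) <|
    hm.comp (hv hdiv)
  have key : Primrec₂ fun (_ : Unit) n => fold z s l r o p k q m (ofNat n) := by
    refine Primrec.nat_strong_rec (fun (_ : Unit) n => fold z s l r o p k q m (ofNat n))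
      (g := fun _ L => some (g L)) (Primrec.option_some.comp (hg.comp Primrec.snd)) ?_
    intro _ n
    have hvn : ∀ i < n, v ((List.range n).map fun e => fold z s l r o p k q m (ofNat e)) i =
        fold z s l r o p k q m (ofNat i) := by
      intro i hi
      simp [v, hi]
    congr 1
    simp only [g, d, List.length_map, List.length_range]
    match n, hvn with
    | 0, _ => simp [ofNat, fold]
    | 1, _ => simp [ofNat, fold]
    | 2, _ => simp [ofNat, fold]
    | 3, _ => simp [ofNat, fold]
    | 4, _ => simp [ofNat, fold]
    | n + 5, hvn =>
      have hm : n / 4 < n + 5 := lt_of_le_of_lt (Nat.div_le_self n 4) (by omega)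
      have m1 := hvn _ (lt_of_le_of_lt (Nat.unpair_left_le _) hm)
      have m2 := hvn _ (lt_of_le_of_lt (Nat.unpair_right_le _) hm)
      have m0 := hvn _ hm
      simp only [Nat.add_sub_cancel, m0, m1, m2]
      rw [if_neg (by omega), if_neg (by omega), if_neg (by omega), if_neg (by omega),
        if_neg (by omega)]
      obtain h | h | h | h : n % 4 = 0 ∨ n % 4 = 1 ∨ n % 4 = 2 ∨ n % 4 = 3 := by omega
      · rw [if_pos h, ofNat_pair h, fold]
      · rw [if_neg (by omega), if_pos h, ofNat_comp h, fold]
      · rw [if_neg (by omega), if_neg (by omega), if_pos h, ofNat_prec h, fold]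
      · rw [if_neg (by omega), if_neg (by omega), if_neg (by omega), ofNat_rfind h, fold]
  exact key.comp (.const ()) .id

theorem exists_partrecCode {f : ℕ → ℕ} (hf : Primrec f) :
    ∃ c : Nat.Partrec.Code, ∀ n, c.eval n = Part.some (f n) := by
  obtain ⟨c, hc⟩ := Nat.Partrec.Code.exists_code.1
    (Nat.Partrec.of_primrec (Primrec.nat_iff.1 hf))
  exact ⟨c, fun n => congrFun hc n⟩

theorem eval_partrecCode_pair {c d : Nat.Partrec.Code} {n a b : ℕ} (hc : c.eval n = Part.some a)
    (hd : d.eval n = Part.some b) : (c.pair d).eval n = Part.some (Nat.pair a b) := by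
  simp [Nat.Partrec.Code.eval, hc, hd, Seq.seq]

theorem eval_partrecCode_comp {c d : Nat.Partrec.Code} {n a b : ℕ} (hd : d.eval n = Part.some a)
    (hc : c.eval a = Part.some b) : (c.comp d).eval n = Part.some b := by
  change (d.eval n).bind c.eval = _
  rw [hd]
  exact (Part.bind_some _ _).trans hc

theorem eval_partrecCode_prec {c d : Nat.Partrec.Code} {a b : ℕ} {step : ℕ → ℕ → ℕ}
    (hc : c.eval a = Part.some b)
    (hd : ∀ y i, d.eval (Nat.pair a (Nat.pair y i)) = Part.some (step y i)) (n : ℕ) :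
    (c.prec d).eval (Nat.pair a n) = Part.some (Nat.rec (motive := fun _ => ℕ) b step n) := by
  induction n with
  | zero => rw [Nat.Partrec.Code.eval_prec_zero]; exact hc
  | succ n ih => rw [Nat.Partrec.Code.eval_prec_succ, ih]; simp [hd]

/-- Bounded evaluation as an ordinary program. The oracle program is translated clause by clause,
the code of the finite oracle being an additional argument; the translation is primitive
recursive. -/
theorem exists_partrecCode_run : ∃ T : ℕ → Nat.Partrec.Code, Primrec T ∧
    ∀ e (σ : List ℕ) n,
      (T e).eval (Nat.pair (Encodable.encode σ) n) = Part.some (run σ (ofNat e) n) := by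
  have h1 : Primrec fun n : ℕ => n.unpair.1 := Primrec.fst.comp .unpair
  have h2 : Primrec fun n : ℕ => n.unpair.2 := Primrec.snd.comp .unpair
  have hL : Primrec fun n : ℕ => ((Encodable.decode (α := List ℕ) n).getD []) :=
    Primrec.option_getD.comp .decode (.const [])
  obtain ⟨z, hz⟩ := exists_partrecCode (Primrec.const 1)
  obtain ⟨s, hs⟩ := exists_partrecCode (Primrec.succ.comp (Primrec.succ.comp h2))
  obtain ⟨l, hl⟩ := exists_partrecCode (Primrec.succ.comp (h1.comp h2))
  obtain ⟨r, hr⟩ := exists_partrecCode (Primrec.succ.comp (h2.comp h2))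
  obtain ⟨o, ho⟩ := exists_partrecCode (Primrec.option_getD.comp (Primrec.option_map
    (Primrec.list_getElem?.comp (hL.comp h1) h2) (Primrec.succ.comp .snd).to₂) (.const 0))
  obtain ⟨kp, hkp⟩ := exists_partrecCode (f := fun n => if n.unpair.1 = 0 ∨ n.unpair.2 = 0 then 0
      else Nat.pair (n.unpair.1 - 1) (n.unpair.2 - 1) + 1) <|
    Primrec.ite ((Primrec.eq.comp h1 (.const 0)).or (Primrec.eq.comp h2 (.const 0))) (.const 0) <|
      Primrec.succ.comp (Primrec₂.natPair.comp (Primrec.pred.comp h1) (Primrec.pred.comp h2))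
  obtain ⟨sel, hsel⟩ := exists_partrecCode (f := fun n => if n.unpair.1 = 0 then 0 else n.unpair.2)
    (Primrec.ite (Primrec.eq.comp h1 (.const 0)) (.const 0) h2)
  obtain ⟨pr, hpr⟩ := exists_partrecCode Primrec.pred
  obtain ⟨c1, hc1⟩ := exists_partrecCode h1
  -- the rearrangement of `(σ, (a, n))` to `((σ, a), n)`
  obtain ⟨ka, hka⟩ := exists_partrecCode (f := fun n =>
      Nat.pair (Nat.pair n.unpair.1 n.unpair.2.unpair.1) n.unpair.2.unpair.2) <|
    Primrec₂.natPair.comp (Primrec₂.natPair.comp h1 (h1.comp h2)) (h2.comp h2)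
  -- the previous value in a primitive recursion, and the argument of the next call
  obtain ⟨ki, hki⟩ := exists_partrecCode (h2.comp h2)
  obtain ⟨kn, hkn⟩ := exists_partrecCode (f := fun n => Nat.pair n.unpair.1.unpair.1
      (Nat.pair n.unpair.1.unpair.2
        (Nat.pair n.unpair.2.unpair.1 (n.unpair.2.unpair.2 - 1)))) <|
    Primrec₂.natPair.comp (h1.comp h1) (Primrec₂.natPair.comp (h2.comp h1)
      (Primrec₂.natPair.comp (h1.comp h2) (Primrec.pred.comp (h2.comp h2))))
  -- the initial state of a search, its bound, its steps, and the argument of the calls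
  obtain ⟨z0, hz0⟩ := exists_partrecCode (Primrec.const 0)
  obtain ⟨kb, hkb⟩ := exists_partrecCode (f := fun n =>
      Nat.pair n ((Encodable.decode (α := List ℕ) n.unpair.1).getD []).length) <|
    Primrec₂.natPair.comp .id (Primrec.list_length.comp (hL.comp h1))
  obtain ⟨ks, hks⟩ := exists_partrecCode (f := fun n =>
      if n.unpair.1.unpair.2 = 0 then if n.unpair.2 = 0 then 1
        else if n.unpair.2 = 1 then n.unpair.1.unpair.1 + 2 else 0
      else n.unpair.1.unpair.2) <|
    Primrec.ite (Primrec.eq.comp (h2.comp h1) (.const 0))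
      (Primrec.ite (Primrec.eq.comp h2 (.const 0)) (.const 1)
        (Primrec.ite (Primrec.eq.comp h2 (.const 1))
          (Primrec.succ.comp (Primrec.succ.comp (h1.comp h1))) (.const 0))) (h2.comp h1)
  obtain ⟨c2, hc2⟩ := exists_partrecCode h2
  obtain ⟨km, hkm⟩ := exists_partrecCode (f := fun n => Nat.pair n.unpair.1.unpair.1
      (Nat.pair n.unpair.1.unpair.2 n.unpair.2.unpair.1)) <|
    Primrec₂.natPair.comp (h1.comp h1) (Primrec₂.natPair.comp (h2.comp h1) (h1.comp h2))
  let P : Nat.Partrec.Code → Nat.Partrec.Code → Nat.Partrec.Code := fun c d => kp.comp (c.pair d)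
  let K : Nat.Partrec.Code → Nat.Partrec.Code → Nat.Partrec.Code := fun c d =>
    sel.comp (d.pair (c.comp (c1.pair (pr.comp d))))
  let Q : Nat.Partrec.Code → Nat.Partrec.Code → Nat.Partrec.Code := fun c d =>
    (c.prec (sel.comp (ki.pair (d.comp kn)))).comp ka
  let M : Nat.Partrec.Code → Nat.Partrec.Code := fun c =>
    pr.comp ((z0.prec (ks.comp (c2.pair (c.comp km)))).comp kb)
  have pc := Nat.Partrec.Code.primrec₂_comp
  have pp := Nat.Partrec.Code.primrec₂_pair
  have pq := Nat.Partrec.Code.primrec₂_prec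
  have hP : Primrec₂ P := pc.comp (.const kp) (pp.comp .fst .snd)
  have hK : Primrec₂ K := pc.comp (.const sel) <| pp.comp .snd <| pc.comp .fst <|
    pp.comp (.const c1) <| pc.comp (.const pr) .snd
  have hQ : Primrec₂ Q := pc.comp (pq.comp .fst <| pc.comp (.const sel) <|
    pp.comp (.const ki) <| pc.comp .snd (.const kn)) (.const ka)
  have hM : Primrec M := pc.comp (.const pr) <| pc.comp (pq.comp (.const z0) <|
    pc.comp (.const ks) <| pp.comp (.const c2) <| pc.comp .id (.const km)) (.const kb)
  refine ⟨_, primrec_fold z s l r o hP hK hQ hM, fun e σ n => ?_⟩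
  generalize ofNat e = c
  have bridge : ∀ {c : Nat.Partrec.Code} {n a b : ℕ}, c.eval n = Part.some a → a = b →
      c.eval n = Part.some b := fun h e => e ▸ h
  induction c generalizing n with
  | zero => exact hz _
  | succ => exact bridge (hs _) (by simp [run])
  | left => exact bridge (hl _) (by simp [run])
  | right => exact bridge (hr _) (by simp [run])
  | oracle => exact bridge (ho _) (by simp [run])
  | pair f g ihf ihg =>
    exact eval_partrecCode_comp (eval_partrecCode_pair (ihf n) (ihg n))
      (bridge (hkp _) (by simp [run]))
  | comp f g ihf ihg =>
    refine eval_partrecCode_comp (eval_partrecCode_pair (ihg n)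
      (eval_partrecCode_comp (eval_partrecCode_pair (bridge (hc1 _) ?_)
        (eval_partrecCode_comp (ihg n) (hpr _))) (ihf _))) (bridge (hsel _) ?_)
    · simp
    · simp [run]
  | prec f g ihf ihg =>
    refine eval_partrecCode_comp (bridge (hka _) (by simp; rfl)) ?_
    exact eval_partrecCode_prec (ihf n.unpair.1) (fun y i => eval_partrecCode_comp
      (eval_partrecCode_pair (bridge (hki _) (by simp; rfl)) (eval_partrecCode_comp
        (bridge (hkn _) (by simp; rfl)) (ihg _))) (bridge (hsel _) (by simp))) _
  | rfind f ih =>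
    refine eval_partrecCode_comp (eval_partrecCode_comp (bridge (hkb _) (by simp; rfl)) ?_) (hpr _)
    exact eval_partrecCode_prec (hz0 _) (fun y i => eval_partrecCode_comp
      (eval_partrecCode_pair (hc2 _) (eval_partrecCode_comp
        (bridge (hkm _) (by simp; rfl)) (ih _))) (bridge (hks _) (by simp))) _

/-- Bounded evaluation is computable, uniformly in the oracle segment and the program. -/
theorem computable_run :
    Computable fun p : List ℕ × ℕ × ℕ => run p.1 (ofNat p.2.1) p.2.2 := by
  obtain ⟨T, hT, h⟩ := exists_partrecCode_run
  refine Partrec.of_eq (Nat.Partrec.Code.eval_part.comp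
    (hT.to_comp.comp (Computable.fst.comp .snd)) (Computable₂.comp Primrec₂.natPair.to_comp
      (Computable.encode.comp .fst) (Computable.snd.comp .snd))) fun p => h _ _ _

end Degrees.Code

/-! ### Decidability relative to a set, and the jump -/

namespace Degrees

theorem _root_.RecursiveIn.of_reducible {α σ : Type*} [Primcodable α] [Primcodable σ]
    {A B : Set ℕ} {f : α →. σ} (hf : RecursiveIn {oracle A} f) (h : Reducible A B) :
    RecursiveIn {oracle B} f :=
  hf.subst fun g hg => by
    rw [Set.mem_singleton_iff.1 hg]
    exact RecursiveIn.iff_nat.2 (reducible_iff.1 h)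

theorem _root_.ComputableIn.of_reducible {α σ : Type*} [Primcodable α] [Primcodable σ]
    {A B : Set ℕ} {f : α → σ} (hf : ComputableIn {oracle A} f) (h : Reducible A B) :
    ComputableIn {oracle B} f :=
  RecursiveIn.of_reducible hf h

open Classical in
/-- The predicate `p` is decidable with oracle `A`. -/
def DecidableIn {α : Type*} [Primcodable α] (A : Set ℕ) (p : α → Prop) : Prop :=
  ComputableIn {oracle A} fun a => decide (p a)

namespace DecidableIn

variable {α β : Type*} [Primcodable α] [Primcodable β] {A B : Set ℕ} {p q : α → Prop}

theorem of_iff (hp : DecidableIn A p) (h : ∀ a, q a ↔ p a) : DecidableIn A q := by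
  obtain rfl : q = p := funext fun a => propext (h a)
  exact hp

theorem of_computableIn (f : α → Bool) (hf : ComputableIn {oracle A} f)
    (h : ∀ a, p a ↔ f a = true) : DecidableIn A p := by
  classical
  refine RecursiveIn.of_eq hf fun a => congrArg Part.some ?_
  rw [Bool.eq_iff_iff, decide_eq_true_iff, h]

theorem computableIn_decide [DecidablePred p] (hp : DecidableIn A p) :
    ComputableIn {oracle A} fun a => decide (p a) := by
  have h : ComputableIn {oracle A} fun a => @decide (p a) (Classical.propDecidable _) := hp
  convert h

theorem of_reducible (hp : DecidableIn A p) (h : Reducible A B) : DecidableIn B p :=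
  ComputableIn.of_reducible hp h

theorem comp {p : β → Prop} (hp : DecidableIn A p) {f : α → β} (hf : ComputableIn {oracle A} f) :
    DecidableIn A fun a => p (f a) :=
  ComputableIn.comp hp hf

theorem not (hp : DecidableIn A p) : DecidableIn A fun a => ¬p a :=
  of_computableIn _ (ComputableIn.comp Primrec.not.computableIn hp) fun a => by simp

theorem and (hp : DecidableIn A p) (hq : DecidableIn A q) : DecidableIn A fun a => p a ∧ q a :=
  of_computableIn _ (ComputableIn.comp₂ Primrec.and.computableIn₂ hp hq) fun a => by simp

theorem eq {σ : Type*} [Primcodable σ] {f g : α → σ} (hf : ComputableIn {oracle A} f)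
    (hg : ComputableIn {oracle A} g) : DecidableIn A fun a => f a = g a := by
  classical
  exact of_computableIn _ (ComputableIn.comp₂ Primrec.eq.decide.computableIn₂ hf hg)
    fun a => by simp

theorem mem (A : Set ℕ) : DecidableIn A fun n => n ∈ A :=
  (eq (Reducible.refl A) (.const 1)).of_iff fun n => by simp [chi]

open Classical in
theorem ite {σ : Type*} [Primcodable σ] {f g : α → σ} (hp : DecidableIn A p)
    (hf : ComputableIn {oracle A} f) (hg : ComputableIn {oracle A} g) :
    ComputableIn {oracle A} fun a => if p a then f a else g a :=
  RecursiveIn.of_eq (ComputableIn.comp (Primrec.cond (α := Bool × σ × σ) .fst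
    (Primrec.fst.comp .snd) (Primrec.snd.comp .snd)).computableIn (hp.pair (hf.pair hg)))
    fun a => by by_cases h : p a <;> simp [h]

open Classical in
theorem rfind {p : α → ℕ → Prop} (hp : DecidableIn A fun x : α × ℕ => p x.1 x.2) :
    RecursiveIn {oracle A} fun a => Nat.rfind fun n => Part.some (decide (p a n)) :=
  RecursiveIn.rfind (p := fun a n => Part.some (decide (p a n))) hp

/-- A witness that always exists can be found by searching for the least one. -/
theorem exists_choice {p : α → ℕ → Prop} (hp : DecidableIn A fun x : α × ℕ => p x.1 x.2)
    (H : ∀ a, ∃ n, p a n) : ∃ m : α → ℕ, ComputableIn {oracle A} m ∧ ∀ a, p a (m a) := by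
  classical
  refine ⟨fun a => Nat.find (H a), hp.rfind.of_eq_tot fun a => ?_, fun a => Nat.find_spec (H a)⟩
  refine Nat.mem_rfind.2 ⟨?_, fun hm => ?_⟩
  · simpa using Nat.find_spec (H a)
  · simpa using Nat.find_min (H a) hm

theorem forall_lt {p : α → ℕ → Prop} {f : α → ℕ} (hf : ComputableIn {oracle A} f)
    (hp : DecidableIn A fun x : α × ℕ => p x.1 x.2) :
    DecidableIn A fun a => ∀ n < f a, p a n := by
  classical
  refine of_computableIn _ (ComputableIn.nat_rec (g := fun _ => true)
    (h := fun a x => x.2 && decide (p a x.1)) hf (.const _)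
    (ComputableIn.comp₂ Primrec.and.computableIn₂ (ComputableIn.snd.comp .snd)
      (hp.comp (f := fun x : α × ℕ × Bool => (x.1, x.2.1))
        (ComputableIn.fst.pair (ComputableIn.fst.comp .snd))))) fun a => ?_
  generalize f a = n
  induction n with
  | zero => simp
  | succ n ih => simp only [Bool.and_eq_true, ← ih, decide_eq_true_iff, Nat.forall_lt_succ_right]

end DecidableIn

theorem Reducible.of_decidableIn {A B : Set ℕ} (h : DecidableIn B fun n => n ∈ A) :
    Reducible A B :=
  RecursiveIn.of_eq (h.ite (.const 1) (.const 0)) fun _ => rfl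

theorem Code.exists_ofNat_eval {A : Set ℕ} {f : ℕ →. ℕ} (hf : RecursiveIn {Degrees.oracle A} f) :
    ∃ e, (ofNat e).eval A = f := by
  obtain ⟨c, hc⟩ := exists_eval.1 (RecursiveIn.iff_nat.1 hf)
  obtain ⟨e, rfl⟩ := ofNat_surjective c
  exact ⟨e, hc⟩

/-- The jump decides convergence of a function that is partial recursive in the set. -/
theorem decidableIn_setJump_dom {α σ : Type*} [Primcodable α] [Primcodable σ] {A : Set ℕ}
    {f : α →. σ} (hf : RecursiveIn {oracle A} f) :
    DecidableIn (setJump A) fun a => (f a).Dom := by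
  obtain ⟨k, hk⟩ := Code.exists_ofNat_eval (RecursiveIn.iff_nat.2 hf)
  -- a program that ignores its argument and runs the program number `k` on `n`
  let j : ℕ → ℕ := fun n => 4 * Nat.pair k (Code.constNum n) + 1 + 5
  have hj : Primrec j := Primrec.nat_add.comp (Primrec.nat_add.comp (Primrec.nat_mul.comp
    (.const 4) (Primrec₂.natPair.comp (.const k) Code.primrec_constNum)) (.const 1)) (.const 5)
  refine ((DecidableIn.mem (setJump A)).comp
    (hj.comp Primrec.encode).computableIn).of_iff fun a => ?_
  obtain ⟨hd, hm⟩ := Code.four_mul_add (Nat.pair k (Code.constNum (Encodable.encode a)))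
    (r := 1) (by omega)
  change _ ↔ ((Code.ofNat (j (Encodable.encode a))).eval A (j (Encodable.encode a))).Dom
  rw [Code.ofNat_comp hm, hd, Nat.unpair_pair, Code.eval_comp, Code.eval_constNum, hk]
  refine Iff.trans ?_ (iff_of_eq (congrArg Part.Dom (Part.bind_some _ _).symm))
  simp [Encodable.encodek]

theorem decidableIn_setJump_exists {α : Type*} [Primcodable α] {A : Set ℕ} {p : α → ℕ → Prop}
    (hp : DecidableIn A fun x : α × ℕ => p x.1 x.2) :
    DecidableIn (setJump A) fun a => ∃ n, p a n := by
  refine (decidableIn_setJump_dom hp.rfind).of_iff fun a => ?_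
  refine Iff.trans ?_ Nat.rfind_dom.symm
  simp

theorem reducible_setJump (A : Set ℕ) : Reducible A (setJump A) :=
  .of_decidableIn <| (decidableIn_setJump_exists (p := fun n _ => n ∈ A)
    ((DecidableIn.mem A).comp .fst)).of_iff fun n => by simp

/-! ### The universal program -/

theorem computableIn_initSeg (A : Set ℕ) : ComputableIn {oracle A} (initSeg A) :=
  ComputableIn.list_map_range .id (ComputableIn.comp (Reducible.refl A) .snd)

theorem computableIn_run {α : Type*} [Primcodable α] {O : Set (ℕ →. ℕ)} {s : α → List ℕ}
    {e n : α → ℕ} (hs : ComputableIn O s) (he : ComputableIn O e) (hn : ComputableIn O n) :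
    ComputableIn O fun a => (Code.ofNat (e a)).run (s a) (n a) :=
  ComputableIn.comp Code.computable_run.computableIn (hs.pair (he.pair hn))

/-- The `e`-th partial function that is recursive in `A`. -/
noncomputable def phi (A : Set ℕ) (e : ℕ) : ℕ →. ℕ := (Code.ofNat e).eval A

/-- The enumeration theorem. -/
theorem recursiveIn_phi (A : Set ℕ) : RecursiveIn {oracle A} fun x : ℕ × ℕ => phi A x.1 x.2 := by
  have h1 : ComputableIn {oracle A} fun y : (ℕ × ℕ) × ℕ =>
      (Code.ofNat y.1.1).run (initSeg A y.2) y.1.2 :=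
    computableIn_run ((computableIn_initSeg A).comp .snd) (ComputableIn.fst.comp .fst)
      (ComputableIn.snd.comp .fst)
  classical
  refine (RecursiveIn.map (g := fun x t => (Code.ofNat x.1).run (initSeg A t) x.2 - 1)
    (DecidableIn.rfind (p := fun x t => ¬(Code.ofNat x.1).run (initSeg A t) x.2 = 0)
      (DecidableIn.eq h1 (.const 0)).not)
    (ComputableIn.comp Primrec.pred.computableIn h1)).of_eq fun x => ?_
  refine Part.ext fun v => ?_
  rw [phi, Code.mem_eval_iff, Part.mem_map_iff]
  constructor
  · rintro ⟨t, ht, rfl⟩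
    have := Part.mem_some_iff.1 (Nat.rfind_spec ht)
    simp only [true_eq_decide_iff] at this
    exact ⟨t, by omega⟩
  · rintro ⟨t, ht⟩
    have hex : ∃ t, ¬(Code.ofNat x.1).run (initSeg A t) x.2 = 0 := ⟨t, by omega⟩
    refine ⟨Nat.find hex, Nat.mem_rfind.2 ⟨?_, fun hm => ?_⟩, ?_⟩
    · simpa using Nat.find_spec hex
    · simpa using Nat.find_min hex hm
    · obtain ⟨w, hw⟩ := Nat.exists_eq_succ_of_ne_zero (Nat.find_spec hex)
      have := Code.run_mono (initSeg_prefix A (Nat.find_min' hex (m := t) (by omega))) _ hw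
      omega

theorem exists_phi_eq {A : Set ℕ} {f : ℕ → ℕ} (hf : ComputableIn {oracle A} f) :
    ∃ e, ∀ n, phi A e n = Part.some (f n) := by
  obtain ⟨e, he⟩ := Code.exists_ofNat_eval hf
  exact ⟨e, fun n => congrFun he n⟩

/-- `e` is an index of a total function that is recursive in `A`. -/
def Total (A : Set ℕ) (e : ℕ) : Prop := ∀ n, (phi A e n).Dom

theorem decidableIn_total (A : Set ℕ) : DecidableIn (setJump (setJump A)) (Total A) := by
  refine (decidableIn_setJump_exists (p := fun e n => ¬(phi A e n).Dom)
    (decidableIn_setJump_dom (recursiveIn_phi A)).not).not.of_iff fun e => ?_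
  simp [Total]

/-! ### Domination -/

/-- If `G` is hyperimmune-free relative to `A`, then a function recursive in `G` is everywhere
below a function recursive in `A`. -/
theorem HyperimmuneFreeRel.exists_le {A G : Set ℕ} (h : HyperimmuneFreeRel (deg G) (deg A))
    {f : ℕ → ℕ} (hf : ComputableIn {oracle G} f) :
    ∃ b : ℕ → ℕ, ComputableIn {oracle A} b ∧ ∀ n, f n ≤ b n := by
  obtain ⟨b, ⟨C, hC, hb⟩, hfb⟩ :=
    h f ⟨setJoin G A, rfl, hf.of_reducible (reducible_setJoin_left G A)⟩
  obtain ⟨N, hN⟩ := Filter.eventually_atTop.1 hfb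
  refine ⟨fun n => b n + ∑ i ∈ Finset.range N, f i,
    ComputableIn.comp₂ Primrec.nat_add.computableIn₂
      (hb.of_reducible (deg_le_deg.1 hC.le)) (.const _), fun n => ?_⟩
  obtain hn | hn := le_or_gt N n
  · exact (hN n hn).trans (Nat.le_add_right _ _)
  · exact (Finset.single_le_sum (f := f) (fun _ _ => Nat.zero_le _)
      (Finset.mem_range.2 hn)).trans (Nat.le_add_left _ _)

/-- Relative to a hyperimmune-free `G`, computations of total functions from a set `B` below `G`
have an `A`-recursive bound on their running time. -/
theorem HyperimmuneFreeRel.exists_run_eq {A B G : Set ℕ}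
    (h : HyperimmuneFreeRel (deg G) (deg A)) (hB : Reducible B G) {e : ℕ} {f : ℕ → ℕ}
    (hf : ∀ n, phi B e n = Part.some (f n)) :
    ∃ k, Total A k ∧ ∀ n, ∀ b ∈ phi A k n, (Code.ofNat e).run (initSeg B b) n = f n + 1 := by
  have hex : ∀ n, ∃ t, ¬(Code.ofNat e).run (initSeg B t) n = 0 := fun n => by
    obtain ⟨t, ht⟩ := Code.mem_eval_iff.1 (Part.eq_some_iff.1 (hf n))
    exact ⟨t, by omega⟩
  obtain ⟨m, hm, hspec⟩ := DecidableIn.exists_choice (A := B) (DecidableIn.eq (computableIn_run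
    ((computableIn_initSeg B).comp .snd) (.const e) .fst) (.const 0)).not hex
  obtain ⟨b, hb, hle⟩ := h.exists_le (hm.of_reducible hB)
  obtain ⟨k, hk⟩ := exists_phi_eq hb
  refine ⟨k, fun n => by rw [hk]; trivial, fun n b' hb' => ?_⟩
  obtain rfl := Part.mem_some_iff.1 (hk n ▸ hb')
  obtain ⟨w, hw⟩ := Nat.exists_eq_succ_of_ne_zero (hspec n)
  have h1 : w = f n :=
    Part.mem_some_iff.1 (hf n ▸ Code.mem_eval_of_run (Code.ofNat e) hw : w ∈ Part.some (f n))
  rw [← h1]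
  exact Code.run_mono (initSeg_prefix B (hle n)) _ hw

/-! ### Presentations from enumerations -/

/-- An enumeration of `U`, with repetitions, along which the order is r.e. and the join is recursive
is a presentation of `U`. -/
theorem sigma01Presentable_of_enumeration {d : Deg} {U : Type} [SemilatticeSup U] (y : ℕ → U)
    (hy : Function.Surjective y) (hle : REInDeg d {x : ℕ × ℕ | y x.1 ≤ y x.2})
    (join : ℕ → ℕ → ℕ) (hjoin : RecursiveInDeg d fun x : ℕ × ℕ => join x.1 x.2)
    (hyj : ∀ i j, y (join i j) = y i ⊔ y j) : Sigma01Presentable d U := by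
  let p : PreStructure :=
    { le := fun i j => y i ≤ y j
      join := join
      isPreorder := { refl := fun _ => le_rfl, trans := fun _ _ _ => le_trans } }
  let f : p.Classes → U := Quotient.lift y fun _ _ h => le_antisymm h.1 h.2
  have hf : Function.Bijective f := by
    refine ⟨?_, fun u => ?_⟩
    · rintro ⟨i⟩ ⟨j⟩ h
      exact Quotient.sound ⟨le_of_eq h, le_of_eq h.symm⟩
    · obtain ⟨i, rfl⟩ := hy u
      exact ⟨p.toClass i, rfl⟩
  exact ⟨p, hle, hjoin, Equiv.ofBijective f hf, fun i j => Iff.rfl, fun i j => hyj i j⟩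

theorem sigma01Presentable_of_unique (d : Deg) (U : Type) [SemilatticeSup U] [Unique U] :
    Sigma01Presentable d U := by
  obtain ⟨A, rfl⟩ : ∃ A, deg A = d := Quotient.exists_rep d
  refine sigma01Presentable_of_enumeration (fun _ => default)
    (fun u => ⟨0, Subsingleton.elim _ _⟩)
    ⟨A, rfl, fun _ => Part.some 0, ComputableIn.const 0, fun x => ?_⟩ (fun _ _ => 0)
    ⟨A, rfl, .const 0⟩ fun _ _ => Subsingleton.elim _ _
  simp

/-! ### Sets with clocked indices -/

/-- The computation of the program number `z.unpair.1` on `n` with oracle `G`, where the number of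
steps is bounded by the value at `n` of the `A`-recursive function with index `z.unpair.2`. As for
`Code.run`, the value `0` means that the bound was too small for an answer. -/
noncomputable def clocked (A G : Set ℕ) (z n : ℕ) : Part ℕ :=
  (phi A z.unpair.2 n).map fun b => (Code.ofNat z.unpair.1).run (initSeg G b) n

/-- `z` is a clocked index: the bound is total, and it suffices for an answer on every input. -/
def Good (A G : Set ℕ) (z : ℕ) : Prop :=
  Total A z.unpair.2 ∧ ∀ n, 0 ∉ clocked A G z n

/-- The set with the clocked index `z`; the value `2` of a bounded evaluation stands for the
answer `1`. -/
def member (A G : Set ℕ) (z : ℕ) : Set ℕ := {n | 2 ∈ clocked A G z n}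

/-- The characteristic function of `member A G z`, as a partial function of `z`. -/
noncomputable def bit (A G : Set ℕ) (z n : ℕ) : Part ℕ :=
  (clocked A G z n).map fun v => if v = 2 then 1 else 0

/-- Initial segments of the characteristic function of `setJoin A (member A G z)`, as a partial
function of `z`. -/
noncomputable def joinSeg (A G : Set ℕ) (z t : ℕ) : Part (List ℕ) :=
  Nat.rec (motive := fun _ => Part (List ℕ)) (Part.some [])
    (fun y IH => IH.bind fun l => (bit A G z (y / 2)).map fun b =>
      l ++ [if y % 2 = 0 then chi A (y / 2) else b]) t

theorem chi_setJoin (A B : Set ℕ) (n : ℕ) :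
    chi (setJoin A B) n = if n % 2 = 0 then chi A (n / 2) else chi B (n / 2) := by
  rcases Nat.mod_two_eq_zero_or_one n with h | h
  · rw [if_pos h]
    exact chi_congr (by simp [setJoin, h])
  · rw [if_neg (by omega)]
    exact chi_congr (by simp [setJoin, h])

theorem chi_injective : Function.Injective chi := fun A B h => Set.ext fun n => by
  have := congrFun h n
  unfold chi at this
  by_cases hA : n ∈ A <;> by_cases hB : n ∈ B <;> simp_all

section Clocked

variable {A G X : Set ℕ}

theorem Good.bit_eq {z : ℕ} (hz : Good A G z) (n : ℕ) :
    bit A G z n = Part.some (chi (member A G z) n) := by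
  obtain ⟨v, hv⟩ : ∃ v, v ∈ clocked A G z n := Part.dom_iff_mem.1 (hz.1 n)
  have h : n ∈ member A G z ↔ v = 2 :=
    ⟨fun h => Part.mem_unique hv h, fun h => by subst h; exact hv⟩
  rw [bit, Part.eq_some_iff.2 hv, Part.map_some, chi]
  simp only [h]

theorem Good.joinSeg_eq {z : ℕ} (hz : Good A G z) (t : ℕ) :
    joinSeg A G z t = Part.some (initSeg (setJoin A (member A G z)) t) := by
  induction t with
  | zero => rfl
  | succ t ih =>
    change (joinSeg A G z t).bind (fun l => (bit A G z (t / 2)).map fun b =>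
      l ++ [if t % 2 = 0 then chi A (t / 2) else b]) = _
    simp only [ih, Part.bind_some, hz.bit_eq, Part.map_some, initSeg, List.range_succ,
      List.map_append, List.map_cons, List.map_nil, chi_setJoin]

theorem recursiveIn_phi_comp (hAG : Reducible A G) {α : Type*} [Primcodable α] {f g : α → ℕ}
    (hf : ComputableIn {oracle G} f) (hg : ComputableIn {oracle G} g) :
    RecursiveIn {oracle G} fun a => phi A (f a) (g a) :=
  RecursiveIn.comp ((recursiveIn_phi A).of_reducible hAG) (hf.pair hg)

theorem recursiveIn_clocked (hAG : Reducible A G) :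
    RecursiveIn {oracle G} fun x : ℕ × ℕ => clocked A G x.1 x.2 := by
  refine RecursiveIn.map (f := fun x : ℕ × ℕ => phi A x.1.unpair.2 x.2)
    (recursiveIn_phi_comp hAG (ComputableIn.snd.comp (ComputableIn.unpair.comp .fst)) .snd) ?_
  exact computableIn_run ((computableIn_initSeg G).comp .snd)
    (ComputableIn.fst.comp (ComputableIn.unpair.comp (ComputableIn.fst.comp .fst)))
    (ComputableIn.snd.comp .fst)

theorem recursiveIn_bit (hAG : Reducible A G) {α : Type*} [Primcodable α] {f g : α → ℕ}
    (hf : ComputableIn {oracle G} f) (hg : ComputableIn {oracle G} g) :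
    RecursiveIn {oracle G} fun a => bit A G (f a) (g a) := by
  have h : RecursiveIn {oracle G} fun x : ℕ × ℕ => bit A G x.1 x.2 :=
    (recursiveIn_clocked hAG).map (Primrec.ite (Primrec.eq.comp .snd (.const 2)) (.const 1)
      (.const 0)).computableIn
  exact h.comp (hf.pair hg)

theorem Good.member_reducible (hAG : Reducible A G) {z : ℕ} (hz : Good A G z) :
    Reducible (member A G z) G :=
  (recursiveIn_bit hAG (.const z) .id).of_eq fun n => hz.bit_eq n

theorem recursiveIn_joinSeg (hAG : Reducible A G) {α : Type} [Primcodable α] {f g : α → ℕ}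
    (hf : ComputableIn {oracle G} f) (hg : ComputableIn {oracle G} g) :
    RecursiveIn {oracle G} fun a => joinSeg A G (f a) (g a) := by
  refine RecursiveIn.nat_rec (f := g) (g := fun _ => Part.some [])
    (h := fun x p => (bit A G (f x) (p.1 / 2)).map fun b =>
      p.2 ++ [if p.1 % 2 = 0 then chi A (p.1 / 2) else b]) hg (ComputableIn.const []) ?_
  have half : ∀ {α : Type} [Primcodable α] {f : α → ℕ}, ComputableIn {oracle G} f →
      ComputableIn {oracle G} fun a => f a / 2 := fun hf =>
    ComputableIn.comp (Primrec.nat_div.comp .id (.const 2)).computableIn hf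
  have par : ∀ {α : Type} [Primcodable α] {f : α → ℕ}, ComputableIn {oracle G} f →
      ComputableIn {oracle G} fun a => f a % 2 := fun hf =>
    ComputableIn.comp (Primrec.nat_mod.comp .id (.const 2)).computableIn hf
  refine RecursiveIn.map (f := fun x : α × ℕ × List ℕ => bit A G (f x.1) (x.2.1 / 2))
    (recursiveIn_bit hAG (hf.comp .fst) (half (ComputableIn.fst.comp .snd))) ?_
  have hy : ComputableIn {oracle G} fun x : (α × ℕ × List ℕ) × ℕ => x.1.2.1 :=
    ComputableIn.fst.comp (ComputableIn.snd.comp .fst)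
  refine ComputableIn.comp₂ (f := fun (l : List ℕ) a => l ++ [a])
    Primrec.list_concat.computableIn₂
    (ComputableIn.snd.comp (ComputableIn.snd.comp .fst)) ?_
  have := DecidableIn.ite (DecidableIn.eq (par hy) (.const 0))
    (ComputableIn.comp (ComputableIn.of_reducible (Reducible.refl A) hAG) (half hy)) .snd
  convert this

/-- The jump of `G` decides universal statements about functions that are partial recursive in
`G`, as long as these are total. -/
theorem DecidableIn.and_forall {α : Type*} [Primcodable α] {T : α → Prop} (hT : DecidableIn X T)
    (hX : Reducible (setJump G) X) {F : α → ℕ →. Bool} (hF : RecursiveIn₂ {oracle G} F)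
    (hdom : ∀ a, T a → ∀ n, (F a n).Dom) :
    DecidableIn X fun a => T a ∧ ∀ n, true ∉ F a n := by
  refine (hT.and ((decidableIn_setJump_dom (RecursiveIn.rfind hF)).of_reducible hX).not).of_iff
    fun a => and_congr_right fun ha => ?_
  rw [Nat.rfind_dom]
  push Not
  exact ⟨fun h n hn => absurd hn (h n), fun h n hn => (h n hn).elim fun m hm =>
    absurd (hdom a ha m) hm.2⟩

theorem decidableIn_good (hAG : Reducible A G) (hA : Reducible (setJump (setJump A)) X)
    (hG : Reducible (setJump G) X) : DecidableIn X (Good A G) := by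
  refine (DecidableIn.and_forall (T := fun z : ℕ => Total A z.unpair.2)
    (F := fun z n => (clocked A G z n).map fun v => decide (v = 0))
    (((decidableIn_total A).of_reducible hA).comp (ComputableIn.snd.comp .unpair)) hG
    ((recursiveIn_clocked hAG).map
      (DecidableIn.computableIn_decide (DecidableIn.eq .snd (.const 0))))
    fun z hz n => hz n).of_iff fun z => ?_
  simp [Good]

/-- If `G` is hyperimmune-free relative to `A`, every set below `G` has a clocked index. -/
theorem exists_good (hHIF : HyperimmuneFreeRel (deg G) (deg A)) {B : Set ℕ} (hB : Reducible B G) :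
    ∃ z, Good A G z ∧ member A G z = B := by
  obtain ⟨e, he⟩ := exists_phi_eq hB
  obtain ⟨k, hk, h⟩ := hHIF.exists_run_eq (.refl G) he
  have key : ∀ n v, v ∈ clocked A G (Nat.pair e k) n → v = chi B n + 1 := by
    intro n v hv
    simp only [clocked, Nat.unpair_pair] at hv
    obtain ⟨b, hb, rfl⟩ := (Part.mem_map_iff _).1 hv
    exact h n b hb
  have hgood : Good A G (Nat.pair e k) := by
    refine ⟨by simpa using hk, fun n hn => ?_⟩
    have := key n _ hn
    omega
  refine ⟨_, hgood, chi_injective (funext fun n => ?_)⟩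
  obtain ⟨v, hv⟩ : ∃ v, v ∈ clocked A G (Nat.pair e k) n := Part.dom_iff_mem.1 (hgood.1 n)
  have h2 := hgood.bit_eq n
  rw [bit, Part.eq_some_iff.2 hv, Part.map_some, key n v hv] at h2
  rw [← Part.some_injective h2]
  unfold chi
  split_ifs <;> simp_all

/-- Reducibility between sets with clocked indices, witnessed by a program and an index of an
`A`-recursive time bound. -/
def ClockedReducible (A G : Set ℕ) (x : (ℕ × ℕ) × ℕ × ℕ) : Prop :=
  (Good A G x.1.1 ∧ Good A G x.1.2 ∧ Total A x.2.2) ∧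
    ∀ n, ∀ b ∈ phi A x.2.2 n,
      (Code.ofNat x.2.1).run (initSeg (setJoin A (member A G x.1.2)) b) n =
        chi (member A G x.1.1) n + 1

theorem decidableIn_clockedReducible (hAG : Reducible A G)
    (hA : Reducible (setJump (setJump A)) X) (hG : Reducible (setJump G) X) :
    DecidableIn X (ClockedReducible A G) := by
  have hgood := decidableIn_good hAG hA hG
  let F : (ℕ × ℕ) × ℕ × ℕ → ℕ →. Bool := fun x n =>
    (phi A x.2.2 n).bind fun b => (joinSeg A G x.1.2 b).bind fun σ =>
      (bit A G x.1.1 n).map fun c => decide (¬(Code.ofNat x.2.1).run σ n = c + 1)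
  have hFval : ∀ x, (Good A G x.1.1 ∧ Good A G x.1.2 ∧ Total A x.2.2) → ∀ n,
      F x n = (phi A x.2.2 n).map fun b =>
        decide (¬(Code.ofNat x.2.1).run (initSeg (setJoin A (member A G x.1.2)) b) n =
          chi (member A G x.1.1) n + 1) := by
    rintro x ⟨h1, h2, -⟩ n
    simp only [F, h2.joinSeg_eq, h1.bit_eq, Part.bind_some, Part.map_some]
    exact Part.bind_some_eq_map _ _
  have hF : RecursiveIn₂ {oracle G} F := by
    have h1 : RecursiveIn {oracle G} fun x : ((ℕ × ℕ) × ℕ × ℕ) × ℕ => phi A x.1.2.2 x.2 :=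
      recursiveIn_phi_comp hAG (ComputableIn.snd.comp (ComputableIn.snd.comp .fst)) .snd
    have h2 : RecursiveIn {oracle G} fun x : (((ℕ × ℕ) × ℕ × ℕ) × ℕ) × ℕ =>
        joinSeg A G x.1.1.1.2 x.2 :=
      recursiveIn_joinSeg hAG (ComputableIn.snd.comp (ComputableIn.fst.comp
        (ComputableIn.fst.comp .fst))) .snd
    have h3 : RecursiveIn {oracle G} fun x : ((((ℕ × ℕ) × ℕ × ℕ) × ℕ) × ℕ) × List ℕ =>
        bit A G x.1.1.1.1.1 x.1.1.2 :=
      recursiveIn_bit hAG (ComputableIn.fst.comp (ComputableIn.fst.comp (ComputableIn.fst.comp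
        (ComputableIn.fst.comp .fst)))) (ComputableIn.snd.comp (ComputableIn.fst.comp .fst))
    have h4 : ComputableIn {oracle G}
        fun x : (((((ℕ × ℕ) × ℕ × ℕ) × ℕ) × ℕ) × List ℕ) × ℕ =>
          decide (¬(Code.ofNat x.1.1.1.1.2.1).run x.1.2 x.1.1.1.2 = x.2 + 1) :=
      DecidableIn.computableIn_decide (DecidableIn.eq (computableIn_run
        (ComputableIn.snd.comp .fst)
        (ComputableIn.fst.comp (ComputableIn.snd.comp (ComputableIn.fst.comp
          (ComputableIn.fst.comp (ComputableIn.fst.comp .fst)))))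
        (ComputableIn.snd.comp (ComputableIn.fst.comp (ComputableIn.fst.comp .fst))))
        (ComputableIn.succ.comp .snd)).not
    exact h1.bind (h2.bind (h3.map h4))
  refine (DecidableIn.and_forall (T := fun x : (ℕ × ℕ) × ℕ × ℕ =>
      Good A G x.1.1 ∧ Good A G x.1.2 ∧ Total A x.2.2) (F := F)
    ((hgood.comp (ComputableIn.fst.comp .fst)).and ((hgood.comp (ComputableIn.snd.comp .fst)).and
      (((decidableIn_total A).of_reducible hA).comp (ComputableIn.snd.comp .snd)))) hG hF
    fun x hx n => ?_).of_iff fun x => and_congr_right fun hx => ?_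
  · rw [hFval x hx n]
    exact hx.2.2 n
  · refine forall_congr' fun n => ?_
    rw [hFval x hx n]
    simp [Part.mem_map_iff]

theorem exists_clockedReducible_iff (hAG : Reducible A G)
    (hHIF : HyperimmuneFreeRel (deg G) (deg A)) {u v : ℕ} (hu : Good A G u) (hv : Good A G v) :
    (∃ e k, ClockedReducible A G ((u, v), (e, k))) ↔
      Reducible (member A G u) (setJoin A (member A G v)) := by
  constructor
  · rintro ⟨e, k, ⟨-, -, hk⟩, h⟩
    refine RecursiveIn.of_eq_tot (((recursiveIn_phi _).comp ((ComputableIn.const e).pair .id)))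
      fun n => ?_
    obtain ⟨b, hb⟩ := Part.dom_iff_mem.1 (hk n)
    exact Code.mem_eval_of_run _ (h n b hb)
  · intro h
    obtain ⟨e, he⟩ := exists_phi_eq h
    obtain ⟨k, hk, h⟩ :=
      hHIF.exists_run_eq (setJoin_reducible hAG (hv.member_reducible hAG)) he
    exact ⟨e, k, ⟨hu, hv, hk⟩, h⟩

/-- `w` is a clocked index of the join of the sets with the clocked indices `u` and `v`. -/
def IsJoinIndex (A G : Set ℕ) (x : (ℕ × ℕ) × ℕ) : Prop :=
  (Good A G x.1.1 ∧ Good A G x.1.2 ∧ Good A G x.2) ∧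
    member A G x.2 = setJoin (member A G x.1.1) (member A G x.1.2)

theorem decidableIn_isJoinIndex (hAG : Reducible A G)
    (hA : Reducible (setJump (setJump A)) X) (hG : Reducible (setJump G) X) :
    DecidableIn X (IsJoinIndex A G) := by
  have hgood := decidableIn_good hAG hA hG
  let F : (ℕ × ℕ) × ℕ → ℕ →. Bool := fun x n =>
    (bit A G x.2 n).bind fun c => (bit A G x.1.1 (n / 2)).bind fun a =>
      (bit A G x.1.2 (n / 2)).map fun b => decide (¬c = if n % 2 = 0 then a else b)
  have hFval : ∀ x, (Good A G x.1.1 ∧ Good A G x.1.2 ∧ Good A G x.2) → ∀ n,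
      F x n = Part.some (decide (¬chi (member A G x.2) n =
        chi (setJoin (member A G x.1.1) (member A G x.1.2)) n)) := by
    rintro x ⟨h1, h2, h3⟩ n
    simp only [F, h1.bit_eq, h2.bit_eq, h3.bit_eq, Part.bind_some, Part.map_some, chi_setJoin]
  have hF : RecursiveIn₂ {oracle G} F := by
    have half : ∀ {α : Type} [Primcodable α] {f : α → ℕ}, ComputableIn {oracle G} f →
        ComputableIn {oracle G} fun a => f a / 2 := fun hf =>
      ComputableIn.comp (Primrec.nat_div.comp .id (.const 2)).computableIn hf
    have h1 : RecursiveIn {oracle G} fun x : ((ℕ × ℕ) × ℕ) × ℕ => bit A G x.1.2 x.2 :=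
      recursiveIn_bit hAG (ComputableIn.snd.comp .fst) .snd
    have h2 : RecursiveIn {oracle G} fun x : (((ℕ × ℕ) × ℕ) × ℕ) × ℕ =>
        bit A G x.1.1.1.1 (x.1.2 / 2) :=
      recursiveIn_bit hAG (ComputableIn.fst.comp (ComputableIn.fst.comp
        (ComputableIn.fst.comp .fst))) (half (ComputableIn.snd.comp .fst))
    have h3 : RecursiveIn {oracle G} fun x : ((((ℕ × ℕ) × ℕ) × ℕ) × ℕ) × ℕ =>
        bit A G x.1.1.1.1.2 (x.1.1.2 / 2) :=
      recursiveIn_bit hAG (ComputableIn.snd.comp (ComputableIn.fst.comp (ComputableIn.fst.comp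
        (ComputableIn.fst.comp .fst))))
        (half (ComputableIn.snd.comp (ComputableIn.fst.comp .fst)))
    have h4 : ComputableIn {oracle G} fun x : (((((ℕ × ℕ) × ℕ) × ℕ) × ℕ) × ℕ) × ℕ =>
        decide (¬x.1.1.2 = if x.1.1.1.2 % 2 = 0 then x.1.2 else x.2) :=
      (PrimrecPred.not (Primrec.eq.comp (Primrec.snd.comp (Primrec.fst.comp .fst))
        (Primrec.ite (Primrec.eq.comp (Primrec.nat_mod.comp
          (Primrec.snd.comp (Primrec.fst.comp (Primrec.fst.comp .fst))) (.const 2)) (.const 0))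
          (Primrec.snd.comp .fst) .snd))).decide.computableIn
    exact h1.bind (h2.bind (h3.map h4))
  refine (DecidableIn.and_forall (T := fun x : (ℕ × ℕ) × ℕ =>
      Good A G x.1.1 ∧ Good A G x.1.2 ∧ Good A G x.2) (F := F)
    ((hgood.comp (ComputableIn.fst.comp .fst)).and ((hgood.comp (ComputableIn.snd.comp .fst)).and
      (hgood.comp .snd))) hG hF fun x hx n => ?_).of_iff fun x => and_congr_right fun hx => ?_
  · rw [hFval x hx n]
    trivial
  · simp only [hFval x hx, Part.mem_some_iff, true_eq_decide_iff, not_not]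
    exact ⟨fun h n => by rw [h], fun h => chi_injective (funext h)⟩

/-- The interval `[deg A, deg G]` is presentable in any `X` that computes the second jump of `A`
and the jump of `G`, if `G` is hyperimmune-free relative to `A`. -/
theorem sigma01Presentable_Icc (hAG : Reducible A G) (hHIF : HyperimmuneFreeRel (deg G) (deg A))
    (hA : Reducible (setJump (setJump A)) X) (hG : Reducible (setJump G) X) :
    Sigma01Presentable (deg X) (Set.Icc (deg A) (deg G)) := by
  classical
  obtain ⟨z₀, hz₀, -⟩ := exists_good hHIF (Reducible.refl G)
  -- indices that are not clocked are replaced by a fixed clocked one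
  let r : ℕ → ℕ := fun z => if Good A G z then z else z₀
  have hr : ComputableIn {oracle X} r := by
    have := DecidableIn.ite (f := fun z => z) (decidableIn_good hAG hA hG) .id (.const z₀)
    convert this
  have hgood : ∀ z, Good A G (r z) := fun z => by
    by_cases h : Good A G z
    · simpa only [r, if_pos h]
    · simpa only [r, if_neg h]
  let y : ℕ → Set.Icc (deg A) (deg G) := fun i => ⟨deg A ⊔ deg (member A G (r i)), le_sup_left,
    sup_le hAG ((hgood i).member_reducible hAG)⟩
  have hyle : ∀ i j, y i ≤ y j ↔
      Reducible (member A G (r i)) (setJoin A (member A G (r j))) := fun i j => by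
    rw [← Subtype.coe_le_coe, ← deg_le_deg, ← deg_sup_deg]
    simp only [y, sup_le_iff, le_sup_left, true_and]
  obtain ⟨m, hm, hspec⟩ := DecidableIn.exists_choice
    (p := fun (x : ℕ × ℕ) w => IsJoinIndex A G ((r x.1, r x.2), w))
    ((decidableIn_isJoinIndex hAG hA hG).comp
      (((hr.comp (ComputableIn.fst.comp .fst)).pair
        (hr.comp (ComputableIn.snd.comp .fst))).pair .snd)) fun x => by
      obtain ⟨w, hw, hwe⟩ := exists_good hHIF (setJoin_reducible
        ((hgood x.1).member_reducible hAG) ((hgood x.2).member_reducible hAG))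
      exact ⟨w, ⟨hgood _, hgood _, hw⟩, hwe⟩
  refine sigma01Presentable_of_enumeration y ?_ ?_ (fun i j => m (i, j)) ⟨X, rfl, hm⟩ ?_
  · rintro ⟨⟨B⟩, hAB, hBG⟩
    obtain ⟨z, hz, hzB⟩ := exists_good hHIF (deg_le_deg.1 hBG)
    refine ⟨z, Subtype.ext ?_⟩
    simp only [y, r, if_pos hz, hzB]
    exact sup_eq_right.2 hAB
  · have hdec : DecidableIn X fun x : (ℕ × ℕ) × ℕ =>
        ClockedReducible A G ((r x.1.1, r x.1.2), x.2.unpair) :=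
      (decidableIn_clockedReducible hAG hA hG).comp
        (((hr.comp (ComputableIn.fst.comp .fst)).pair
          (hr.comp (ComputableIn.snd.comp .fst))).pair (ComputableIn.unpair.comp .snd))
    refine ⟨X, rfl, _, DecidableIn.rfind
      (p := fun (x : ℕ × ℕ) t => ClockedReducible A G ((r x.1, r x.2), t.unpair)) hdec,
      fun x => ?_⟩
    rw [Set.mem_ofPred_eq, hyle, ← exists_clockedReducible_iff hAG hHIF (hgood _) (hgood _)]
    refine Iff.trans ?_ Nat.rfind_dom.symm
    simp only [Part.mem_some_iff, true_eq_decide_iff, Part.some_dom, implies_true, and_true]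
    exact ⟨fun ⟨e, k, h⟩ => ⟨Nat.pair e k, by rwa [Nat.unpair_pair]⟩, fun ⟨t, h⟩ => ⟨_, _, h⟩⟩
  · intro i j
    obtain ⟨⟨-, -, hw⟩, h⟩ := hspec (i, j)
    refine Subtype.ext ?_
    simp only [y, Set.Icc.coe_sup]
    rw [show r (m (i, j)) = m (i, j) from if_pos hw, h, ← deg_sup_deg]
    exact sup_sup_distrib_left _ _ _

end Clocked

/-! ### Hyperimmune-free degrees below the jump -/

section BelowJump

variable {A G : Set ℕ}

/-- The part of the jump of `A` that is enumerated within `s` steps. -/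
def setJumpAt (A : Set ℕ) (s : ℕ) : Set ℕ := {e | ¬(Code.ofNat e).run (initSeg A s) e = 0}

theorem initSeg_setJumpAt (A : Set ℕ) (t : ℕ) :
    ∃ s₀, ∀ s ≥ s₀, initSeg (setJumpAt A s) t = initSeg (setJump A) t := by
  have key : ∀ e, ∃ s₀, ∀ s ≥ s₀, (e ∈ setJumpAt A s ↔ e ∈ setJump A) := by
    intro e
    have hsub : ∀ s, e ∈ setJumpAt A s → e ∈ setJump A := fun s hs => by
      obtain ⟨v, hv⟩ := Nat.exists_eq_succ_of_ne_zero hs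
      exact Part.dom_iff_mem.2 ⟨v, Code.mem_eval_of_run _ hv⟩
    by_cases he : e ∈ setJump A
    · obtain ⟨v, hv⟩ := Part.dom_iff_mem.1 he
      obtain ⟨s₀, hs₀⟩ := Code.mem_eval_iff.1 hv
      refine ⟨s₀, fun s hs => iff_of_true ?_ he⟩
      have := Code.run_mono (initSeg_prefix A hs) _ hs₀
      change ¬_ = 0
      omega
    · exact ⟨0, fun s _ => iff_of_false (fun h => he (hsub s h)) he⟩
  choose m hm using key
  refine ⟨∑ e ∈ Finset.range t, m e, fun s hs => List.map_congr_left fun e he => ?_⟩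
  refine chi_congr (hm e s (le_trans ?_ hs))
  exact Finset.single_le_sum (f := m) (fun _ _ => Nat.zero_le _)
    (Finset.mem_range.2 (List.mem_range.1 he))

/-- The limit lemma: a total function recursive in the jump of `A` is the limit of an `A`-recursive
sequence. -/
theorem exists_limit {f : ℕ → ℕ} (hf : ComputableIn {oracle (setJump A)} f) :
    ∃ r : ℕ → ℕ → ℕ, ComputableIn₂ {oracle A} r ∧ ∀ n, ∃ s₀, ∀ s ≥ s₀, r n s = f n := by
  obtain ⟨e, he⟩ := exists_phi_eq hf
  refine ⟨fun n s => (Code.ofNat e).run (initSeg (setJumpAt A s) s) n - 1, ?_, fun n => ?_⟩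
  · refine ComputableIn.comp Primrec.pred.computableIn
      (computableIn_run ?_ (.const e) .fst)
    refine ComputableIn.list_map_range .snd ?_
    have := DecidableIn.ite (A := A) (p := fun x : (ℕ × ℕ) × ℕ => x.2 ∈ setJumpAt A x.1.2)
      (DecidableIn.eq (computableIn_run ((computableIn_initSeg A).comp
        (ComputableIn.snd.comp .fst)) .snd .snd) (.const 0)).not (.const 1) (.const 0)
    exact this
  · obtain ⟨t, ht⟩ := Code.mem_eval_iff.1 (Part.eq_some_iff.1 (he n))
    obtain ⟨s₀, hs₀⟩ := initSeg_setJumpAt A t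
    refine ⟨max s₀ t, fun s hs => ?_⟩
    rw [← hs₀ s (by omega)] at ht
    have hts := Code.run_mono (initSeg_prefix _ ((le_max_right s₀ t).trans hs)) _ ht
    exact congrArg (· - 1) hts

/-- A set below the jump of `A` that is hyperimmune-free relative to `A` is recursive in `A`. Let
`r` approximate `G`. There is an `A`-recursive `b` such that, for every `n` and `p`, the
approximation is correct at some stage between `p` and `b n p`; hence a value that does not
change between these stages is correct. -/
theorem HyperimmuneFreeRel.reducible_of_le_jump (h : HyperimmuneFreeRel (deg G) (deg A))
    (hAG : Reducible A G) (hG : Reducible G (setJump A)) : Reducible G A := by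
  obtain ⟨r, hr, hlim⟩ := exists_limit hG
  obtain ⟨m, hm, hspec⟩ := DecidableIn.exists_choice (A := G)
    (p := fun q s => q.unpair.2 ≤ s ∧ r q.unpair.1 s = chi G q.unpair.1)
    (DecidableIn.and
      (DecidableIn.of_computableIn (fun x : ℕ × ℕ => decide (x.1.unpair.2 ≤ x.2))
        (Primrec.nat_le.comp (Primrec.snd.comp (Primrec.unpair.comp .fst))
          .snd).decide.computableIn fun x => by simp)
      (DecidableIn.eq
        ((hr.of_reducible hAG).comp ((ComputableIn.fst.comp (ComputableIn.unpair.comp .fst)).pair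
          .snd))
        (ComputableIn.comp (Reducible.refl G)
          (ComputableIn.fst.comp (ComputableIn.unpair.comp .fst)))))
    fun q => by
      obtain ⟨s₀, hs₀⟩ := hlim q.unpair.1
      exact ⟨max q.unpair.2 s₀, le_max_left _ _, hs₀ _ (le_max_right _ _)⟩
  obtain ⟨b, hb, hmb⟩ := h.exists_le hm
  have hbp : ComputableIn {oracle A} fun x : ℕ × ℕ => b (Nat.pair x.1 x.2) :=
    hb.comp Primrec₂.natPair.computableIn₂
  -- the approximation does not change between the stages `p` and `b n p`
  have hdec : DecidableIn A fun x : ℕ × ℕ =>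
      ∀ s < b (Nat.pair x.1 x.2) + 1, ¬(x.2 ≤ s ∧ ¬r x.1 s = r x.1 x.2) := by
    refine DecidableIn.forall_lt (p := fun (x : ℕ × ℕ) s => ¬(x.2 ≤ s ∧ ¬r x.1 s = r x.1 x.2))
      (ComputableIn.succ.comp hbp) (DecidableIn.and
      (DecidableIn.of_computableIn (fun x : (ℕ × ℕ) × ℕ => decide (x.1.2 ≤ x.2))
        (Primrec.nat_le.comp (Primrec.snd.comp .fst) .snd).decide.computableIn fun x => by simp)
      (DecidableIn.eq (hr.comp ((ComputableIn.fst.comp .fst).pair .snd))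
        (hr.comp .fst)).not).not
  obtain ⟨p, hp, hstable⟩ := DecidableIn.exists_choice
    (p := fun n p => ∀ s < b (Nat.pair n p) + 1, ¬(p ≤ s ∧ ¬r n s = r n p)) hdec fun n => by
    obtain ⟨s₀, hs₀⟩ := hlim n
    exact ⟨s₀, fun s _ hs => hs.2 (by rw [hs₀ s hs.1, hs₀ s₀ le_rfl])⟩
  refine RecursiveIn.of_eq (hr.comp (ComputableIn.id.pair hp)) fun n => congrArg Part.some ?_
  obtain ⟨h1, h2⟩ := hspec (Nat.pair n (p n))
  rw [Nat.unpair_pair] at h1 h2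
  have h3 := hstable n (m (Nat.pair n (p n))) (Nat.lt_succ_of_le (hmb _))
  push Not at h3
  exact (h3 h1).symm.trans h2

end BelowJump

end Degrees

theorem lemma2p9 (a g x : Degrees.Deg) (hag : a ≤ g) (hgx : g ≤ x)
    (hx : a.jump.jump ≤ x ∨ x = a.jump)
    (hlat : Degrees.IsLatticeOrder (Set.Icc a g))
    (hGL : Degrees.GL1Rel a g)
    (hHIF : Degrees.HyperimmuneFreeRel g a) :
    Degrees.Sigma01Presentable x (Set.Icc a g) := by
  obtain ⟨A, rfl⟩ : ∃ A, Degrees.deg A = a := Quotient.exists_rep a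
  obtain ⟨G, rfl⟩ : ∃ G, Degrees.deg G = g := Quotient.exists_rep g
  obtain hx | rfl := hx
  · obtain ⟨X, rfl⟩ : ∃ X, Degrees.deg X = x := Quotient.exists_rep x
    have hG : (Degrees.deg G).jump ≤ Degrees.deg X := by
      rw [hGL]
      exact sup_le hgx (le_trans (Degrees.reducible_setJump (Degrees.setJump A)) hx)
    exact Degrees.sigma01Presentable_Icc hag hHIF hx hG
  · -- the interval consists of `a` alone
    have hGA : Degrees.deg G = Degrees.deg A :=
      le_antisymm (hHIF.reducible_of_le_jump hag hgx) hag
    rw [hGA]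
    have : Unique (Set.Icc (Degrees.deg A) (Degrees.deg A)) :=
      { default := ⟨_, le_rfl, le_rfl⟩
        uniq := fun u => Subtype.ext (le_antisymm u.2.2 u.2.1) }
    exact Degrees.sigma01Presentable_of_unique _ _
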